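/- Let $\mathbb R_+=(0,\infty)$. For $1\le p<\infty$ let $X^p(\mathbb R_+)$ be the space of measurable $f:\mathbb R_+\to\mathbb C$ with $\|f\|_{X^p}=\big(\int_0^\infty |f(x)|^p\,\frac{dx}{x}\big)^{1/p}<\infty$, and let $X^\infty(\mathbb R_+)$ be the space of measurable $f$ with $\|f\|_{X^\infty}=\sup_{x>0}|f(x)|<\infty$. Let $\Theta=x\frac{d}{dx}$ be the infinitesimal generator of the group $U(t)f(x)=f(e^tx)$, $t\in\mathbb R$, in $X^p(\mathbb R_+)$, that is, $\Theta f=\lim_{t\to0}\frac{U(t)f-f}{t}$ in the norm of $X^p(\mathbb R_+)$. For $\sigma>0$ let $\mathbf B^p_\sigma(\Theta)$ be the set of all $f\in X^p(\mathbb R_+)$ which belong to the domain of $\Theta^k$ for every $k\in\mathbb N$ and satisfy $\|\Theta^kf\|_{X^p}\le\sigma^k\|f\|_{X^p}$ for every $k\in\mathbb N$. Let $\{t_k\}_{k\in\mathbb Z}$ be real numbers with $\sup_{k\in\mathbb Z}|t_k-k|<\frac14$, and put $$G(z)=(z-t_0)\prod_{k=1}^\infty\Big(1-\frac z{t_k}\Big)\Big(1-\frac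 z{t_{-k}}\Big),\qquad z\in\mathbb C .$$ **Theorem.** Let $1\le p\le\infty$, $\frac1p+\frac1q=1$, $0<\delta<\pi$, $f\in\mathbf B^p_{\pi-\delta}(\Theta)$ and $g\in X^q(\mathbb R_+)$. Then the product defining $G$ converges for every $z$, $G$ is entire and $G'(t_k)\ne0$ for all $k$; the integral $$\Phi(t)=\int_{\mathbb R_+}f(e^tx)\,g(x)\,\frac{dx}{x}$$ converges absolutely for every $t\in\mathbb R$; and $\Phi$ extends to an entire function, again denoted by $\Phi$, for which $$\Phi(t)=\sum_{k\in\mathbb Z}\Phi(t_k)\,\frac{G(t)}{G'(t_k)\,(t-t_k)},\qquad t\in\mathbb C,$$ uniformly on compact subsets of $\mathbb C$; here the sum is the limit of $\sum_{k=-M}^{N}$ as $M,N\to\infty$ independently, and at $t=t_k$ the $k$-th fraction stands for its limit, $1$. -/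

import Mathlib

open MeasureTheory Set Filter Topology
open scoped ENNReal

noncomputable section

namespace Mellin

/- Functions on the half line `ℝ₊ = (0, ∞)` are represented by functions `ℝ → ℂ`; only their
values on `Ioi 0` matter in what follows. -/

/-- The norm of `X^p(ℝ₊)`: the `L^p(ℝ₊)` norm of `x ↦ f x * x^(-1/p)` if `p < ∞`, and
`sup_{x > 0} |f x|` if `p = ∞`. -/
def xNorm (p : ℝ≥0∞) (f : ℝ → ℂ) : ℝ≥0∞ :=
  if p = ∞ then ⨆ x ∈ Ioi (0 : ℝ), ‖f x‖ₑ
  else eLpNorm (fun x : ℝ => f x * ((x ^ (-1 / p.toReal) : ℝ) : ℂ)) p (volume.restrict (Ioi 0))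

/-- Membership in `X^p(ℝ₊)`: Lebesgue measurable on `ℝ₊`, with finite `X^p` norm. -/
def MemX (p : ℝ≥0∞) (f : ℝ → ℂ) : Prop :=
  AEStronglyMeasurable f (volume.restrict (Ioi 0)) ∧ xNorm p f < ∞

/-- The Mellin translations `U(t) f(x) = f(e^t x)`. -/
def U (t : ℝ) (f : ℝ → ℂ) : ℝ → ℂ := fun x => f (Real.exp t * x)

/-- `h = Θ f`, where `Θ = x d/dx` is the infinitesimal generator of the group `U` in `X^p(ℝ₊)`:
both functions are in `X^p(ℝ₊)` and `(U(t) f - f) / t → h` in the `X^p` norm as `t → 0`. -/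
def IsTheta (p : ℝ≥0∞) (f h : ℝ → ℂ) : Prop :=
  MemX p f ∧ MemX p h ∧
    Tendsto (fun t : ℝ => xNorm p (fun x => (U t f x - f x) / (t : ℂ) - h x)) (𝓝[≠] 0) (𝓝 0)

/-- The Bernstein space `B_σ^p(Θ)`: all `f` which lie in the domain of every power of `Θ`
(the sequence `F` is `F k = Θ^k f`) and satisfy `‖Θ^k f‖ ≤ σ^k ‖f‖` for all `k`. -/
def bernsteinSpace (p : ℝ≥0∞) (σ : ℝ) : Set (ℝ → ℂ) :=
  {f | ∃ F : ℕ → ℝ → ℂ, F 0 = f ∧ (∀ k, IsTheta p (F k) (F (k + 1))) ∧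
    ∀ k, xNorm p (F k) ≤ ENNReal.ofReal σ ^ k * xNorm p f}

/-- The pairing `Φ(t) = ∫_{ℝ₊} f(e^t x) g(x) dx/x`, for real `t`. -/
def pairing (f g : ℝ → ℂ) (t : ℝ) : ℂ :=
  ∫ x in Ioi (0 : ℝ), f (Real.exp t * x) * g x / (x : ℂ)

/-- The paired factor `(1 - z / t_k) (1 - z / t_{-k})`, for `k = n + 1`. -/
def samplingFactor (τ : ℤ → ℝ) (z : ℂ) (n : ℕ) : ℂ :=
  (1 - z / (τ (n + 1) : ℂ)) * (1 - z / (τ (-(n + 1)) : ℂ))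

/-- The generating function
`G(z) = (z - t_0) ∏_{k = 1}^∞ (1 - z / t_k) (1 - z / t_{-k})`. -/
def generatingFunction (τ : ℤ → ℝ) (z : ℂ) : ℂ :=
  (z - (τ 0 : ℂ)) * ∏' n : ℕ, samplingFactor τ z n

/-- The interpolating function `G(z) / (G'(t_k) (z - t_k))`, with the removable singularity at
`z = t_k` filled in by its limit `1`. -/
def samplingKernel (τ : ℤ → ℝ) (k : ℤ) (z : ℂ) : ℂ :=
  if z = (τ k : ℂ) then 1
  else generatingFunction τ z /
    (deriv (generatingFunction τ) (τ k : ℂ) * (z - (τ k : ℂ)))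

end Mellin

end

/-!
The derivatives of the pairing are the pairings with `Θ ^ k f`, hence bounded by `C σ ^ k` with
`σ = π - δ`. So the Taylor series about all real points sum to one and the same entire function `Φ`,
and expanding about `re z` gives `‖Φ z‖ ≤ C exp (σ |im z|)`.

The remainder `Φ z - ∑ k ∈ [-M, N], …` of the sampling series is
`G z / (2πi) * ∮ Φ w / ((w - z) * G w) dw` over the circle through `-M - 1/2` and `N + 1/2` which is
symmetric about the real axis. To bound `G` from below there, compare it factor by factor with
`sin (π z) / π`, the case `t_k = k`: by partial fractions
`∑ |z| / (|k| |t_k - z|) ≤ 4 log |z| + O(1)` away from the nodes, so `|sin (π z)|` is at most a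
constant times `|z| ^ (4L) |G z|`. With `ρ = min M N`, the integrand is
`O(ρ ^ (4L - 1) exp (-δ |im w|))`; Jordan's inequality bounds the integral of the exponential over
the circle independently of its radius, and the remainder vanishes in the limit because `4L < 1`.
-/

section EntireExtension

variable {E : Type*} [NormedAddCommGroup E] [NormedSpace ℂ E] {φ : ℝ → E} {B σ : ℝ}

/-- The `k`-th term of the Taylor series about the real point `s` of a function of a real variable,
evaluated at a complex number `z` in order to extend the function to the plane. -/
noncomputable def taylorTerm (φ : ℝ → E) (z : ℂ) (s : ℝ) (k : ℕ) : E :=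
  ((z - s) ^ k / (k.factorial : ℂ)) • iteratedDeriv k φ s

lemma norm_taylorTerm_le (hB : ∀ k s, ‖iteratedDeriv k φ s‖ ≤ B * σ ^ k) (z : ℂ) (s : ℝ) (k : ℕ) :
    ‖taylorTerm φ z s k‖ ≤ B * ((σ * ‖z - s‖) ^ k / k.factorial) := by
  rw [taylorTerm, norm_smul, norm_div, norm_pow, Complex.norm_natCast]
  calc ‖z - s‖ ^ k / k.factorial * ‖iteratedDeriv k φ s‖
      ≤ ‖z - s‖ ^ k / k.factorial * (B * σ ^ k) := by gcongr; exact hB k s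
    _ = B * ((σ * ‖z - s‖) ^ k / k.factorial) := by rw [mul_pow]; ring

-- The derivative of a Taylor polynomial with respect to its centre telescopes.
lemma hasDerivAt_sum_taylorTerm_center (hφ : ContDiff ℝ (⊤ : ℕ∞) φ) (z : ℂ) (n : ℕ)
    (s : ℝ) :
    HasDerivAt (fun s : ℝ => ∑ k ∈ Finset.range (n + 1), taylorTerm φ z s k)
      (((z - s) ^ n / (n.factorial : ℂ)) • iteratedDeriv (n + 1) φ s) s := by
  have hderiv (k : ℕ) : HasDerivAt (iteratedDeriv k φ) (iteratedDeriv (k + 1) φ s) s := by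
    rw [iteratedDeriv_succ]
    exact (hφ.differentiable_iteratedDeriv k (by exact_mod_cast WithTop.coe_lt_top k) s).hasDerivAt
  have hcenter : HasDerivAt (fun s : ℝ => z - (s : ℂ)) (-1) s := by
    simpa using (Complex.ofRealCLM.hasDerivAt (x := s)).const_sub z
  induction n with
  | zero => simpa [taylorTerm] using hderiv 0
  | succ n ih =>
    simp_rw [Finset.sum_range_succ _ (n + 1)]
    refine (ih.add (((hcenter.pow (n + 1)).div_const _).smul (hderiv (n + 1)))).congr_deriv ?_
    have hfactorial : ((n.factorial : ℕ) : ℂ) ≠ 0 := by exact_mod_cast n.factorial_ne_zero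
    have hsucc : (n : ℂ) + 1 ≠ 0 := by exact_mod_cast n.succ_ne_zero
    have hcancel : ((n + 1 : ℕ) * (z - s) ^ n * (-1 : ℂ)) / ((n + 1).factorial : ℂ) =
        -((z - s) ^ n / (n.factorial : ℂ)) := by
      rw [Nat.factorial_succ]
      push_cast
      field_simp
    simp only [add_tsub_cancel_right, hcancel, neg_smul, Pi.pow_apply]
    abel

lemma norm_tsum_taylorTerm_le (hB : ∀ k s, ‖iteratedDeriv k φ s‖ ≤ B * σ ^ k) (z : ℂ) (s : ℝ) :
    ‖∑' k, taylorTerm φ z s k‖ ≤ B * Real.exp (σ * ‖z - s‖) := by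
  refine tsum_of_norm_bounded (HasSum.mul_left B ?_) (norm_taylorTerm_le hB z s)
  rw [Real.exp_eq_exp_ℝ]
  exact NormedSpace.expSeries_div_hasSum_exp _

variable [CompleteSpace E]

lemma summable_taylorTerm (hB : ∀ k s, ‖iteratedDeriv k φ s‖ ≤ B * σ ^ k) (z : ℂ) (s : ℝ) :
    Summable (taylorTerm φ z s) :=
  .of_norm_bounded ((Real.summable_pow_div_factorial (σ * ‖z - s‖)).mul_left B)
    (norm_taylorTerm_le hB z s)

lemma tsum_taylorTerm_center_eq (hφ : ContDiff ℝ (⊤ : ℕ∞) φ)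
    (hB : ∀ k s, ‖iteratedDeriv k φ s‖ ≤ B * σ ^ k) (z : ℂ) (s₁ s₂ : ℝ) :
    ∑' k, taylorTerm φ z s₁ k = ∑' k, taylorTerm φ z s₂ k := by
  set T : ℕ → ℝ → E := fun n s => ∑ k ∈ Finset.range (n + 1), taylorTerm φ z s k
  have hlim (s : ℝ) : Tendsto (T · s) atTop (𝓝 (∑' k, taylorTerm φ z s k)) :=
    (tendsto_add_atTop_iff_nat 1).2 (summable_taylorTerm hB z s).hasSum.tendsto_sum_nat
  obtain ⟨M, hM⟩ := isCompact_uIcc.exists_bound_of_continuousOn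
    (f := fun s : ℝ => z - (s : ℂ)) (s := uIcc s₂ s₁) (by fun_prop)
  have hest (n : ℕ) :
      ‖T n s₁ - T n s₂‖ ≤ B * σ * ((σ * M) ^ n / n.factorial) * ‖s₁ - s₂‖ := by
    refine Convex.norm_image_sub_le_of_norm_hasDerivWithin_le
      (fun s _ => (hasDerivAt_sum_taylorTerm_center hφ z n s).hasDerivWithinAt) (fun s hs => ?_)
      (convex_uIcc s₂ s₁) left_mem_uIcc right_mem_uIcc
    rw [norm_smul, norm_div, norm_pow, Complex.norm_natCast]
    have hM₀ : 0 ≤ M := (norm_nonneg _).trans (hM s hs)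
    calc ‖z - s‖ ^ n / n.factorial * ‖iteratedDeriv (n + 1) φ s‖
        ≤ M ^ n / n.factorial * (B * σ ^ (n + 1)) := by
          gcongr
          exacts [hM s hs, hB _ _]
      _ = B * σ * ((σ * M) ^ n / n.factorial) := by rw [mul_pow]; ring
  have hzero : Tendsto (fun n => T n s₁ - T n s₂) atTop (𝓝 0) := by
    refine squeeze_zero_norm hest ?_
    simpa using ((FloorSemiring.tendsto_pow_div_factorial_atTop (σ * M)).const_mul
      (B * σ)).mul_const ‖s₁ - s₂‖
  exact sub_eq_zero.1 (tendsto_nhds_unique ((hlim s₁).sub (hlim s₂)) hzero)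

lemma differentiable_tsum_taylorTerm (hB : ∀ k s, ‖iteratedDeriv k φ s‖ ≤ B * σ ^ k)
    (hσ : 0 ≤ σ) (s : ℝ) : Differentiable ℂ fun z => ∑' k, taylorTerm φ z s k := by
  intro z
  have hB₀ : 0 ≤ B := by simpa using (norm_nonneg _).trans (hB 0 0)
  have hopen : IsOpen (Metric.ball (s : ℂ) (‖z - s‖ + 1)) := Metric.isOpen_ball
  refine (Complex.differentiableOn_tsum_of_summable_norm
    ((Real.summable_pow_div_factorial (σ * (‖z - s‖ + 1))).mul_left B) (fun k => ?_) hopen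
    fun k w hw => ?_).differentiableAt (hopen.mem_nhds (by simp [dist_eq_norm]))
  · unfold taylorTerm
    exact Differentiable.differentiableOn (by fun_prop)
  · rw [mem_ball_iff_norm] at hw
    refine (norm_taylorTerm_le hB w s k).trans ?_
    gcongr

lemma exists_entire_extension (hφ : ContDiff ℝ (⊤ : ℕ∞) φ)
    (hB : ∀ k s, ‖iteratedDeriv k φ s‖ ≤ B * σ ^ k) (hσ : 0 ≤ σ) :
    ∃ Φ : ℂ → E, Differentiable ℂ Φ ∧ (∀ t : ℝ, Φ t = φ t) ∧
      ∀ z : ℂ, ‖Φ z‖ ≤ B * Real.exp (σ * |z.im|) := by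
  refine ⟨fun z => ∑' k, taylorTerm φ z 0 k, differentiable_tsum_taylorTerm hB hσ 0,
    fun t => ?_, fun z => ?_⟩
  · simp only
    rw [tsum_taylorTerm_center_eq hφ hB t 0 t,
      tsum_eq_single 0 fun k hk => by simp [taylorTerm, hk]]
    simp [taylorTerm]
  · have him : ‖z - (z.re : ℂ)‖ = |z.im| := by
      rw [show z - (z.re : ℂ) = z.im * Complex.I by
        rw [sub_eq_iff_eq_add', Complex.re_add_im]]
      simp
    simp only
    rw [tsum_taylorTerm_center_eq hφ hB z 0 z.re, ← him]
    exact norm_tsum_taylorTerm_le hB z z.re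

end EntireExtension

/-- The product `∏ i, F i` of entire functions converges normally on bounded sets: on each
disc the `F i - 1` have a summable majorant. Such a product is entire, and vanishes only where one
of its factors does. -/
structure NormallyConvergentProduct {ι : Type*} (F : ι → ℂ → ℂ) : Prop where
  differentiable (i : ι) : Differentiable ℂ (F i)
  exists_summable_bound (r : ℝ) :
    ∃ u : ι → ℝ, Summable u ∧ ∀ i z, ‖z‖ ≤ r → ‖F i z - 1‖ ≤ u i

namespace NormallyConvergentProduct

variable {ι : Type*} {F : ι → ℂ → ℂ}

lemma summable_norm_sub_one (hF : NormallyConvergentProduct F) (z : ℂ) :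
    Summable fun i => ‖F i z - 1‖ := by
  obtain ⟨u, hu, hle⟩ := hF.exists_summable_bound ‖z‖
  exact hu.of_nonneg_of_le (fun _ => norm_nonneg _) fun i => hle i z le_rfl

lemma multipliable (hF : NormallyConvergentProduct F) (z : ℂ) : Multipliable (F · z) := by
  simpa using multipliable_one_add_of_summable (hF.summable_norm_sub_one z)

lemma tprod_ne_zero (hF : NormallyConvergentProduct F) {z : ℂ} (hz : ∀ i, F i z ≠ 0) :
    ∏' i, F i z ≠ 0 := by
  simpa using tprod_one_add_ne_zero_of_summable (f := fun i => F i z - 1) (by simpa using hz)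
    (hF.summable_norm_sub_one z)

lemma differentiable_tprod (hF : NormallyConvergentProduct F) :
    Differentiable ℂ fun z => ∏' i, F i z := by
  intro z
  obtain ⟨u, hu, hle⟩ := hF.exists_summable_bound (‖z‖ + 1)
  have hopen : IsOpen (Metric.ball (0 : ℂ) (‖z‖ + 1)) := Metric.isOpen_ball
  have hprod := hu.hasProdLocallyUniformlyOn_one_add hopen (f := fun i z => F i z - 1)
    (Eventually.of_forall fun i w hw => hle i w (mem_ball_zero_iff.1 hw).le)
    fun i => ((hF.differentiable i).continuous.sub continuous_const).continuousOn
  simp only [add_sub_cancel] at hprod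
  rw [hasProdLocallyUniformlyOn_iff_tendstoLocallyUniformlyOn] at hprod
  refine (hprod.differentiableOn (Eventually.of_forall fun s => ?_) hopen).differentiableAt
    (hopen.mem_nhds (by simp))
  exact (Differentiable.fun_finsetProd fun i _ => hF.differentiable i).differentiableOn

lemma update_one [DecidableEq ι] (hF : NormallyConvergentProduct F) (m : ι) :
    NormallyConvergentProduct (Function.update F m 1) where
  differentiable i := by
    rcases eq_or_ne i m with rfl | hi
    · simp
    · simpa [hi] using hF.differentiable i
  exists_summable_bound r := by
    obtain ⟨u, hu, hle⟩ := hF.exists_summable_bound r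
    refine ⟨fun i => |u i|, hu.abs, fun i z hz => ?_⟩
    rcases eq_or_ne i m with rfl | hi
    · simp
    · simpa [hi] using (hle i z hz).trans (le_abs_self _)

lemma tprod_eq_mul_tprod_update [DecidableEq ι] (hF : NormallyConvergentProduct F) (m : ι)
    (z : ℂ) :
    ∏' i, F i z = F m z * ∏' i, Function.update F m 1 i z := by
  have happly (i : ι) : Function.update F m 1 i z = Function.update (F · z) m 1 i := by
    rcases eq_or_ne i m with rfl | hi <;> simp [*]
  simp only [happly]
  rw [Multipliable.tprod_eq_mul_tprod_ite' m]
  · simp only [Function.update_apply]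
  · simpa only [happly] using (hF.update_one m).multipliable z

lemma deriv_tprod_ne_zero (hF : NormallyConvergentProduct F) {m : ι} {a : ℂ} (hm : F m a = 0)
    (hderiv : deriv (F m) a ≠ 0) (hne : ∀ i ≠ m, F i a ≠ 0) :
    deriv (fun z => ∏' i, F i z) a ≠ 0 := by
  classical
  have hrest : ∏' i, Function.update F m 1 i a ≠ 0 := by
    refine (hF.update_one m).tprod_ne_zero fun i => ?_
    rcases eq_or_ne i m with rfl | hi
    · simp
    · simpa [hi] using hne i hi
  rw [funext (hF.tprod_eq_mul_tprod_update m),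
    deriv_fun_mul (hF.differentiable m a) ((hF.update_one m).differentiable_tprod a), hm, zero_mul,
    add_zero]
  exact mul_ne_zero hderiv hrest

end NormallyConvergentProduct

section Sums

lemma sum_natAbs_sub_le_two_mul_sum {S : Finset ℤ} {T : Finset ℕ} {m : ℤ}
    (hS : ∀ k ∈ S, (k - m).natAbs ∈ T) {h : ℕ → ℝ} (hh : ∀ j ∈ T, 0 ≤ h j) :
    ∑ k ∈ S, h (k - m).natAbs ≤ 2 * ∑ j ∈ T, h j := by
  rw [← Finset.sum_fiberwise_of_maps_to hS, Finset.mul_sum]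
  refine Finset.sum_le_sum fun j hj => ?_
  have hcard : (S.filter fun k => (k - m).natAbs = j).card ≤ 2 := by
    refine (Finset.card_le_card (t := {m + j, m - j}) fun k hk => ?_).trans Finset.card_le_two
    simp only [Finset.mem_filter, Finset.mem_insert, Finset.mem_singleton] at hk ⊢
    omega
  calc ∑ k ∈ S with (k - m).natAbs = j, h (k - m).natAbs
      = (S.filter fun k => (k - m).natAbs = j).card * h j := by
        rw [← nsmul_eq_mul, ← Finset.sum_const]
        exact Finset.sum_congr rfl fun k hk => by rw [(Finset.mem_filter.1 hk).2]
    _ ≤ 2 * h j := mul_le_mul_of_nonneg_right (by exact_mod_cast hcard) (hh j hj)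

lemma sum_range_one_div_succ_le (n : ℕ) :
    ∑ j ∈ Finset.range n, 1 / ((j : ℝ) + 1) ≤ 1 + Real.log n := by
  simpa [harmonic] using harmonic_le_one_add_log n

lemma sum_range_one_div_succ_sq_le (n : ℕ) :
    ∑ j ∈ Finset.range n, 1 / ((j : ℝ) + 1) ^ 2 ≤ 2 := by
  have hsum := sum_Ioo_inv_sq_le (α := ℝ) 0 (n + 1)
  rw [← Finset.Ico_succ_left_eq_Ioo, Finset.sum_Ico_eq_sum_range] at hsum
  simpa [add_comm] using hsum

lemma one_div_le_one_div_add {η d x b : ℝ} (hη : 0 < η) (hd : η ≤ d) (hx : 0 < x) (hb : 0 ≤ b)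
    (hxd : x ≤ d + b) : 1 / d ≤ 1 / x + b * (1 + b / η) * (1 / x ^ 2) := by
  have hd₀ : 0 < d := hη.trans_le hd
  have hinv : 1 / d ≤ (1 + b / η) / x := by
    rw [div_le_div_iff₀ hd₀ hx]
    have : b ≤ b / η * d := by
      rw [div_mul_eq_mul_div, le_div_iff₀ hη]
      gcongr
    linarith
  calc 1 / d = 1 / x + (x - d) * (1 / d) / x := by
        field_simp
        ring
    _ ≤ 1 / x + b * ((1 + b / η) / x) / x := by
        have : (x - d) * (1 / d) ≤ b * ((1 + b / η) / x) :=
          mul_le_mul (by linarith) hinv (by positivity) hb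
        gcongr
    _ = 1 / x + b * (1 + b / η) * (1 / x ^ 2) := by
        field_simp

lemma sum_one_div_le_two_mul_log {S : Finset ℤ} {w : ℤ → ℝ} {m : ℤ} {n : ℕ} {η b : ℝ} (hη : 0 < η)
    (hb : 0 ≤ b) (hw : ∀ k ∈ S, η ≤ w k) (hwm : ∀ k ∈ S, |(k : ℝ) - m| + 1 ≤ w k + b)
    (hS : ∀ k ∈ S, (k - m).natAbs < n) :
    ∑ k ∈ S, 1 / w k ≤ 2 * (1 + Real.log n) + 4 * (b * (1 + b / η)) := by
  set c := b * (1 + b / η)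
  have : 0 ≤ c := by positivity
  calc ∑ k ∈ S, 1 / w k
      ≤ ∑ k ∈ S, (1 / (((k - m).natAbs : ℝ) + 1) +
          c * (1 / (((k - m).natAbs : ℝ) + 1) ^ 2)) := by
        refine Finset.sum_le_sum fun k hk =>
          one_div_le_one_div_add hη (hw k hk) (by positivity) hb ?_
        have := hwm k hk
        rw [Nat.cast_natAbs]
        push_cast
        exact this
    _ ≤ 2 * ∑ j ∈ Finset.range n, (1 / ((j : ℝ) + 1) + c * (1 / ((j : ℝ) + 1) ^ 2)) :=
        sum_natAbs_sub_le_two_mul_sum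
          (h := fun j => 1 / ((j : ℝ) + 1) + c * (1 / ((j : ℝ) + 1) ^ 2))
          (fun k hk => Finset.mem_range.2 (hS k hk)) fun j _ => by positivity
    _ ≤ 2 * ((1 + Real.log n) + c * 2) := by
        rw [Finset.sum_add_distrib, ← Finset.mul_sum]
        gcongr
        exacts [sum_range_one_div_succ_le n, sum_range_one_div_succ_sq_le n]
    _ = 2 * (1 + Real.log n) + 4 * c := by ring

lemma sum_one_div_sq_le {S : Finset ℤ} {K : ℕ} (hS : ∀ k ∈ S, K < k.natAbs) :
    ∑ k ∈ S, 1 / (k : ℝ) ^ 2 ≤ 4 / ((K : ℝ) + 1) := by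
  set n := S.sup Int.natAbs
  calc ∑ k ∈ S, 1 / (k : ℝ) ^ 2 = ∑ k ∈ S, (((k - 0).natAbs : ℝ) ^ 2)⁻¹ :=
        Finset.sum_congr rfl fun k _ => by simp [Nat.cast_natAbs]
    _ ≤ 2 * ∑ j ∈ Finset.Ioo K (n + 1), ((j : ℝ) ^ 2)⁻¹ := by
        refine sum_natAbs_sub_le_two_mul_sum (h := fun j => ((j : ℝ) ^ 2)⁻¹) (fun k hk => ?_)
          fun j _ => by positivity
        have hle : k.natAbs ≤ n := Finset.le_sup hk
        have hlt := hS k hk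
        simp only [sub_zero, Finset.mem_Ioo]
        omega
    _ ≤ 2 * (2 / ((K : ℝ) + 1)) := by
        gcongr
        exact sum_Ioo_inv_sq_le K (n + 1)
    _ = 4 / ((K : ℝ) + 1) := by ring

end Sums

lemma log_floor_add_round_le {z : ℂ} (hz : 1 ≤ ‖z‖) :
    Real.log (⌊4 * ‖z‖⌋₊ + (round z.re).natAbs + 1 : ℕ) ≤ Real.log ‖z‖ + 6 := by
  have hround : ((round z.re).natAbs : ℝ) ≤ ‖z‖ + 1 / 2 := by
    have hdist := abs_sub_round z.re
    rw [abs_sub_comm] at hdist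
    rw [Nat.cast_natAbs, Int.cast_abs]
    linarith [abs_sub_abs_le_abs_sub (round z.re : ℝ) z.re, Complex.abs_re_le_norm z]
  have hle : ((⌊4 * ‖z‖⌋₊ + (round z.re).natAbs + 1 : ℕ) : ℝ) ≤ 7 * ‖z‖ := by
    have hfloor : (⌊4 * ‖z‖⌋₊ : ℝ) ≤ 4 * ‖z‖ := Nat.floor_le (by positivity)
    push_cast
    linarith
  have hlog := Real.log_le_log (by positivity) hle
  rw [Real.log_mul (by norm_num) (by positivity)] at hlog
  have hlog_seven : Real.log 7 ≤ 7 - 1 := Real.log_le_sub_one_of_pos (by norm_num)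
  linarith

lemma norm_one_sub_div_le_mul_exp {a b z : ℂ} (ha : a ≠ 0) (hb : b ≠ 0) (hz : a - z ≠ 0) :
    ‖1 - z / b‖ ≤ ‖1 - z / a‖ * Real.exp (‖a - b‖ * (‖z‖ / (‖b‖ * ‖a - z‖))) := by
  have hfactor : 1 - z / b = (1 - z / a) * (1 - (a - b) * z / (b * (a - z))) := by
    field_simp
    ring
  rw [hfactor, norm_mul]
  gcongr
  calc ‖1 - (a - b) * z / (b * (a - z))‖ ≤ 1 + ‖(a - b) * z / (b * (a - z))‖ := by
        simpa using norm_sub_le 1 ((a - b) * z / (b * (a - z)))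
    _ = ‖a - b‖ * (‖z‖ / (‖b‖ * ‖a - z‖)) + 1 := by
        rw [norm_div, norm_mul, norm_mul, mul_div_assoc, add_comm]
    _ ≤ _ := Real.add_one_le_exp _

section SineLowerBound

lemma norm_sin_sq (z : ℂ) : ‖Complex.sin z‖ ^ 2 = Real.sin z.re ^ 2 + Real.sinh z.im ^ 2 := by
  have hsin : Complex.sin z = ((Real.sin z.re * Real.cosh z.im : ℝ) : ℂ) +
      ((Real.cos z.re * Real.sinh z.im : ℝ) : ℂ) * Complex.I := by
    rw [Complex.sin_eq]
    push_cast
    rfl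
  rw [hsin, Complex.sq_norm, Complex.normSq_add_mul_I, mul_pow, mul_pow, Real.cosh_sq,
    Real.cos_sq']
  ring

lemma exp_abs_im_sq_le (z : ℂ) : Real.exp |z.im| ^ 2 ≤ 4 * (1 + ‖Complex.sin z‖ ^ 2) := by
  have hcosh : Real.exp |z.im| ≤ 2 * Real.cosh z.im := by
    rw [← Real.cosh_abs, Real.cosh_eq]
    linarith [Real.exp_pos (-|z.im|)]
  calc Real.exp |z.im| ^ 2 ≤ (2 * Real.cosh z.im) ^ 2 := by gcongr
    _ = 4 * (1 + Real.sinh z.im ^ 2) := by rw [mul_pow, Real.cosh_sq]; ring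
    _ ≤ 4 * (1 + ‖Complex.sin z‖ ^ 2) := by
        rw [norm_sin_sq]
        linarith [sq_nonneg (Real.sin z.re)]

lemma two_mul_abs_sub_round_le_abs_sin (x : ℝ) :
    2 * |x - round x| ≤ |Real.sin (Real.pi * x)| := by
  have hperiod : |Real.sin (Real.pi * x)| = |Real.sin (Real.pi * (x - round x))| := by
    rw [mul_sub, mul_comm Real.pi (round x : ℝ), Real.sin_sub_int_mul_pi, abs_mul, abs_zpow,
      abs_neg, abs_one, one_zpow, one_mul]
  have habs : |Real.pi * (x - round x)| = Real.pi * |x - round x| := by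
    rw [abs_mul, abs_of_pos Real.pi_pos]
  have hjordan := Real.mul_abs_le_abs_sin (x := Real.pi * (x - round x)) (by
    rw [habs]
    linarith [mul_le_mul_of_nonneg_left (abs_sub_round x) Real.pi_pos.le])
  rwa [habs, ← mul_assoc, div_mul_cancel₀ _ Real.pi_ne_zero, ← hperiod] at hjordan

lemma two_mul_abs_le_abs_sinh (y : ℝ) : 2 * |y| ≤ |Real.sinh (Real.pi * y)| := by
  have hpi : 2 * |y| ≤ |Real.pi * y| := by
    rw [abs_mul, abs_of_pos Real.pi_pos]
    gcongr
    exact Real.two_le_pi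
  rw [Real.abs_sinh]
  exact hpi.trans (Real.self_le_sinh_iff.2 (abs_nonneg _))

lemma two_mul_norm_sub_round_le_norm_sin (z : ℂ) :
    2 * ‖z - round z.re‖ ≤ ‖Complex.sin (Real.pi * z)‖ := by
  refine le_of_sq_le_sq ?_ (norm_nonneg _)
  have hre := pow_le_pow_left₀ (by positivity) (two_mul_abs_sub_round_le_abs_sin z.re) 2
  have him := pow_le_pow_left₀ (by positivity) (two_mul_abs_le_abs_sinh z.im) 2
  rw [mul_pow, sq_abs, sq_abs] at hre him
  rw [norm_sin_sq, Complex.re_ofReal_mul, Complex.im_ofReal_mul, mul_pow, Complex.sq_norm,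
    Complex.normSq_apply]
  simp only [Complex.sub_re, Complex.sub_im, Complex.intCast_re, Complex.intCast_im, sub_zero]
  linarith

lemma exp_pi_mul_abs_im_le_norm_sin {z : ℂ} (hz : ∀ k : ℤ, 1 / 2 ≤ ‖(k : ℂ) - z‖) :
    Real.exp (Real.pi * |z.im|) ≤ 3 * ‖Complex.sin (Real.pi * z)‖ := by
  have hone : 1 ≤ ‖Complex.sin (Real.pi * z)‖ := by
    have hround := hz (round z.re)
    rw [norm_sub_rev] at hround
    linarith [two_mul_norm_sub_round_le_norm_sin z]
  have hexp := exp_abs_im_sq_le (Real.pi * z)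
  rw [Complex.im_ofReal_mul, abs_mul, abs_of_pos Real.pi_pos] at hexp
  refine le_of_sq_le_sq ?_ (by positivity)
  nlinarith

end SineLowerBound

section JordanEstimate

lemma integral_exp_neg_mul_le {a : ℝ} (ha : 0 < a) (b : ℝ) :
    ∫ x in (0 : ℝ)..b, Real.exp (-(a * x)) ≤ 1 / a := by
  have hderiv (x : ℝ) : HasDerivAt (fun x => -(1 / a) * Real.exp (-(a * x)))
      (Real.exp (-(a * x))) x := by
    refine (((hasDerivAt_const_mul a).neg.exp).const_mul (-(1 / a))).congr_deriv ?_
    field_simp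
    rfl
  rw [intervalIntegral.integral_eq_sub_of_hasDerivAt (fun x _ => hderiv x)
    (Continuous.intervalIntegrable (by fun_prop) _ _)]
  have : 0 ≤ 1 / a * Real.exp (-(a * b)) := by positivity
  simp only [mul_zero, neg_zero, Real.exp_zero]
  linarith

lemma exp_neg_mul_sin_le {a : ℝ} (ha : 0 ≤ a) {θ : ℝ} (hθ : θ ∈ Icc 0 Real.pi) :
    Real.exp (-(a * Real.sin θ)) ≤ Real.exp (-(a * (2 / Real.pi) * θ)) +
      Real.exp (-(a * (2 / Real.pi) * (Real.pi - θ))) := by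
  rcases le_total θ (Real.pi / 2) with h | h
  · refine le_add_of_le_of_nonneg (Real.exp_le_exp.2 (neg_le_neg ?_)) (Real.exp_pos _).le
    rw [mul_assoc]
    exact mul_le_mul_of_nonneg_left (Real.mul_le_sin hθ.1 h) ha
  · refine le_add_of_nonneg_of_le (Real.exp_pos _).le (Real.exp_le_exp.2 (neg_le_neg ?_))
    rw [mul_assoc, ← Real.sin_pi_sub θ]
    exact mul_le_mul_of_nonneg_left
      (Real.mul_le_sin (by linarith [hθ.2]) (by linarith)) ha

lemma integral_exp_neg_mul_sin_le {a : ℝ} (ha : 0 < a) :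
    ∫ θ in (0 : ℝ)..Real.pi, Real.exp (-(a * Real.sin θ)) ≤ Real.pi / a := by
  set b : ℝ := a * (2 / Real.pi) with hb
  have hb0 : 0 < b := by positivity
  have hreflect : ∫ θ in (0 : ℝ)..Real.pi, Real.exp (-(b * (Real.pi - θ))) =
      ∫ θ in (0 : ℝ)..Real.pi, Real.exp (-(b * θ)) := by
    simpa using intervalIntegral.integral_comp_sub_left (fun θ => Real.exp (-(b * θ)))
      (a := 0) (b := Real.pi) Real.pi
  calc ∫ θ in (0 : ℝ)..Real.pi, Real.exp (-(a * Real.sin θ))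
      ≤ ∫ θ in (0 : ℝ)..Real.pi,
          (Real.exp (-(b * θ)) + Real.exp (-(b * (Real.pi - θ)))) :=
        intervalIntegral.integral_mono_on Real.pi_pos.le
          (Continuous.intervalIntegrable (by fun_prop) _ _)
          (Continuous.intervalIntegrable (by fun_prop) _ _)
          fun θ hθ => exp_neg_mul_sin_le ha.le hθ
    _ ≤ 1 / b + 1 / b := by
        rw [intervalIntegral.integral_add (Continuous.intervalIntegrable (by fun_prop) _ _)
          (Continuous.intervalIntegrable (by fun_prop) _ _), hreflect]
        gcongr <;> exact integral_exp_neg_mul_le hb0 _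
    _ = Real.pi / a := by
        rw [hb]
        field_simp
        norm_num

lemma integral_exp_neg_mul_abs_sin_le {a : ℝ} (ha : 0 < a) :
    ∫ θ in (0 : ℝ)..2 * Real.pi, Real.exp (-(a * |Real.sin θ|)) ≤ 2 * Real.pi / a := by
  have hcont : Continuous fun θ => Real.exp (-(a * |Real.sin θ|)) := by fun_prop
  have hshift : ∫ θ in Real.pi..2 * Real.pi, Real.exp (-(a * |Real.sin θ|)) =
      ∫ θ in (0 : ℝ)..Real.pi, Real.exp (-(a * |Real.sin θ|)) := by
    simpa [Real.sin_add_pi, ← two_mul] using (intervalIntegral.integral_comp_add_right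
      (fun θ => Real.exp (-(a * |Real.sin θ|))) (a := 0) (b := Real.pi) Real.pi).symm
  have habs : ∫ θ in (0 : ℝ)..Real.pi, Real.exp (-(a * |Real.sin θ|)) =
      ∫ θ in (0 : ℝ)..Real.pi, Real.exp (-(a * Real.sin θ)) := by
    refine intervalIntegral.integral_congr fun θ hθ => ?_
    rw [uIcc_of_le Real.pi_pos.le] at hθ
    simp only [abs_of_nonneg (Real.sin_nonneg_of_mem_Icc hθ)]
  rw [← intervalIntegral.integral_add_adjacent_intervals
    (hcont.intervalIntegrable 0 Real.pi) (hcont.intervalIntegrable Real.pi _), hshift, habs,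
    ← two_mul, mul_div_assoc]
  gcongr
  exact integral_exp_neg_mul_sin_le ha

lemma norm_circleIntegral_le_of_norm_le_mul_exp_neg_abs_im {E : Type*} [NormedAddCommGroup E]
    [NormedSpace ℂ E] {f : ℂ → E} {A δ R c : ℝ} (hδ : 0 < δ) (hR : 0 < R) (hA : 0 ≤ A)
    (hf : ∀ w ∈ Metric.sphere (c : ℂ) R, ‖f w‖ ≤ A * Real.exp (-(δ * |w.im|))) :
    ‖∮ w in C((c : ℂ), R), f w‖ ≤ A * (2 * Real.pi / δ) := by
  have hpoint (θ : ℝ) : ‖deriv (circleMap (c : ℂ) R) θ • f (circleMap c R θ)‖ ≤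
      A * R * Real.exp (-(δ * R * |Real.sin θ|)) := by
    have him : (circleMap (c : ℂ) R θ).im = R * Real.sin θ := by
      simp [circleMap, Complex.exp_ofReal_mul_I_im]
    have hle := hf _ (circleMap_mem_sphere (c : ℂ) hR.le θ)
    rw [him, abs_mul, abs_of_pos hR, ← mul_assoc] at hle
    rw [deriv_circleMap, norm_smul, norm_mul, norm_circleMap_zero, Complex.norm_I, mul_one,
      abs_of_pos hR, mul_comm A, mul_assoc]
    gcongr
  calc ‖∮ w in C((c : ℂ), R), f w‖
      ≤ ∫ θ in (0 : ℝ)..2 * Real.pi, A * R * Real.exp (-(δ * R * |Real.sin θ|)) :=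
        intervalIntegral.norm_integral_le_of_norm_le Real.two_pi_pos.le
          (Eventually.of_forall fun θ _ => hpoint θ)
          (Continuous.intervalIntegrable (by fun_prop) _ _)
    _ ≤ A * R * (2 * Real.pi / (δ * R)) := by
        rw [intervalIntegral.integral_const_mul]
        gcongr
        exact integral_exp_neg_mul_abs_sin_le (mul_pos hδ hR)
    _ = A * (2 * Real.pi / δ) := by field_simp

end JordanEstimate

section SimpleZeros

lemma ne_of_mem_sphere_of_mem_ball {E : Type*} [PseudoMetricSpace E] {c w s : E} {R : ℝ}
    (hw : w ∈ Metric.sphere c R) (hs : s ∈ Metric.ball c R) : w ≠ s := by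
  rintro rfl
  exact (Metric.mem_ball.1 hs).ne hw

lemma inv_eval_nodal_id {S : Finset ℂ} (hS : S.Nonempty) {w : ℂ} (hw : ∀ s ∈ S, w ≠ s) :
    ((Lagrange.nodal S id).eval w)⁻¹ = ∑ s ∈ S, Lagrange.nodalWeight S id s * (w - s)⁻¹ := by
  have hsum := congrArg (Polynomial.eval w) (Lagrange.sum_basis (injOn_id (S : Set ℂ)) hS)
  rw [Polynomial.eval_finsetSum, Polynomial.eval_one, Finset.sum_congr rfl fun s hs =>
    Lagrange.eval_basis_not_at_node hs (hw s hs), ← Finset.mul_sum] at hsum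
  exact inv_eq_of_mul_eq_one_right hsum

lemma circleIntegral_div_eval_nodal {c : ℂ} {R : ℝ} (hR : 0 ≤ R) {u : ℂ → ℂ}
    (hu : DiffContOnCl ℂ u (Metric.ball c R)) {S : Finset ℂ} (hS : ↑S ⊆ Metric.ball c R) :
    ∮ w in C(c, R), u w / (Lagrange.nodal S id).eval w =
      2 * Real.pi * Complex.I * ∑ s ∈ S, Lagrange.nodalWeight S id s * u s := by
  rcases S.eq_empty_or_nonempty with rfl | hne
  · simpa using hu.circleIntegral_eq_zero hR
  · have hint (s : ℂ) (hs : s ∈ S) :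
        CircleIntegrable (fun w => Lagrange.nodalWeight S id s * ((w - s)⁻¹ • u w)) c R := by
      refine ContinuousOn.circleIntegrable hR (continuousOn_const.mul (ContinuousOn.smul
        (ContinuousOn.inv₀ (by fun_prop) fun w hw =>
          sub_ne_zero.2 (ne_of_mem_sphere_of_mem_ball hw (hS hs))) ?_))
      exact hu.continuousOn_ball.mono Metric.sphere_subset_closedBall
    calc ∮ w in C(c, R), u w / (Lagrange.nodal S id).eval w
        = ∮ w in C(c, R), ∑ s ∈ S, Lagrange.nodalWeight S id s * ((w - s)⁻¹ • u w) := by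
          refine circleIntegral.integral_congr hR fun w hw => ?_
          simp only [div_eq_mul_inv, smul_eq_mul]
          rw [inv_eval_nodal_id hne fun s hs => ne_of_mem_sphere_of_mem_ball hw (hS hs),
            mul_comm, Finset.sum_mul]
          simp only [mul_assoc]
      _ = ∑ s ∈ S, Lagrange.nodalWeight S id s * (2 * Real.pi * Complex.I * u s) := by
          rw [circleIntegral.integral_fun_sum hint]
          refine Finset.sum_congr rfl fun s hs => ?_
          rw [circleIntegral.integral_const_mul, hu.circleIntegral_sub_inv_smul (hS hs),
            smul_eq_mul]
      _ = _ := by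
          rw [Finset.mul_sum]
          exact Finset.sum_congr rfl fun s _ => by ring

lemma diffContOnCl_dslope {U : Set ℂ} (hU : IsOpen U) {g : ℂ → ℂ} (hg : DiffContOnCl ℂ g U)
    {a : ℂ} (ha : a ∈ U) : DiffContOnCl ℂ (dslope g a) U where
  differentiableOn :=
    (Complex.differentiableOn_dslope (hU.mem_nhds ha)).2 hg.differentiableOn
  continuousOn := (continuousOn_dslope (mem_of_superset (hU.mem_nhds ha) subset_closure)).2
    ⟨hg.continuousOn, hg.differentiableAt hU ha⟩

lemma exists_eq_eval_nodal_mul {U : Set ℂ} (hU : IsOpen U) {g : ℂ → ℂ}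
    (hg : DiffContOnCl ℂ g U) {S : Finset ℂ} (hSU : ↑S ⊆ U) (hS : ∀ s ∈ S, g s = 0) :
    ∃ Q : ℂ → ℂ, DiffContOnCl ℂ Q U ∧ ∀ z, g z = (Lagrange.nodal S id).eval z * Q z := by
  induction S using Finset.induction_on with
  | empty => exact ⟨g, hg, by simp⟩
  | insert a S ha ih =>
    rw [Finset.coe_insert, insert_subset_iff] at hSU
    obtain ⟨Q, hQ, hgQ⟩ := ih hSU.2 fun s hs => hS s (Finset.mem_insert_of_mem hs)
    have hQa : Q a = 0 := by
      have hprod := hgQ a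
      rw [hS a (Finset.mem_insert_self a S), eq_comm, mul_eq_zero] at hprod
      exact hprod.resolve_left
        (Lagrange.eval_nodal_not_at_node fun s hs h => ha (by rwa [h]))
    refine ⟨dslope Q a, diffContOnCl_dslope hU hQ hSU.1, fun z => ?_⟩
    have hslope := sub_smul_dslope Q a z
    rw [hQa, sub_zero, smul_eq_mul] at hslope
    rw [hgQ, Lagrange.nodal_insert_eq_nodal ha, Polynomial.eval_mul, ← hslope]
    simp only [Polynomial.eval_sub, Polynomial.eval_X, Polynomial.eval_C, id]
    ring

lemma hasDerivAt_eval_nodal_mul {S : Finset ℂ} {s : ℂ} (hs : s ∈ S) {Q : ℂ → ℂ}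
    (hQ : DifferentiableAt ℂ Q s) :
    HasDerivAt (fun z => (Lagrange.nodal S id).eval z * Q z)
      ((Lagrange.nodalWeight S id s)⁻¹ * Q s) s := by
  have hnode := Lagrange.eval_nodal_at_node (v := id) hs
  refine (((Lagrange.nodal S id).hasDerivAt s).mul hQ.hasDerivAt).congr_deriv ?_
  rw [Lagrange.nodalWeight_eq_eval_derivative_nodal hs, inv_inv, ← id_eq s, hnode]
  simp

theorem circleIntegral_div_of_simple_zeros {c : ℂ} {R : ℝ} (hR : 0 < R) {f g : ℂ → ℂ}
    (hf : DiffContOnCl ℂ f (Metric.ball c R)) (hg : DiffContOnCl ℂ g (Metric.ball c R))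
    {S : Finset ℂ} (hS : ↑S ⊆ Metric.ball c R)
    (hzero : ∀ w ∈ Metric.closedBall c R, g w = 0 ↔ w ∈ S) (hsimple : ∀ s ∈ S, deriv g s ≠ 0) :
    ∮ w in C(c, R), f w / g w = 2 * Real.pi * Complex.I * ∑ s ∈ S, f s / deriv g s := by
  obtain ⟨Q, hQ, hgQ⟩ := exists_eq_eval_nodal_mul Metric.isOpen_ball hg hS fun s hs =>
    (hzero s (Metric.ball_subset_closedBall (hS hs))).2 hs
  have hderiv (s : ℂ) (hs : s ∈ S) : deriv g s = (Lagrange.nodalWeight S id s)⁻¹ * Q s := by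
    rw [funext hgQ]
    exact (hasDerivAt_eval_nodal_mul hs (hQ.differentiableAt Metric.isOpen_ball (hS hs))).deriv
  have hQ0 (w : ℂ) (hw : w ∈ closure (Metric.ball c R)) : Q w ≠ 0 := by
    rw [closure_ball c hR.ne'] at hw
    by_cases hwS : w ∈ S
    · exact right_ne_zero_of_mul (hderiv w hwS ▸ hsimple w hwS)
    · exact right_ne_zero_of_mul (hgQ w ▸ mt (hzero w hw).1 hwS)
  calc ∮ w in C(c, R), f w / g w
      = ∮ w in C(c, R), (Q w)⁻¹ • f w / (Lagrange.nodal S id).eval w := by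
        refine circleIntegral.integral_congr hR.le fun w _ => ?_
        simp only [hgQ w, div_eq_mul_inv, mul_inv, smul_eq_mul]
        ring
    _ = 2 * Real.pi * Complex.I * ∑ s ∈ S, Lagrange.nodalWeight S id s * ((Q s)⁻¹ • f s) :=
        circleIntegral_div_eval_nodal hR.le ((hQ.inv hQ0).smul hf) hS
    _ = 2 * Real.pi * Complex.I * ∑ s ∈ S, f s / deriv g s := by
        congr 1
        refine Finset.sum_congr rfl fun s hs => ?_
        rw [hderiv s hs, smul_eq_mul, div_eq_mul_inv, mul_inv, inv_inv]
        ring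

end SimpleZeros

namespace Mellin

section Pairing

lemma eLpNorm_weighted_le_xNorm (p : ℝ≥0∞) (f : ℝ → ℂ) :
    eLpNorm (fun x : ℝ => f x * ((x ^ (-1 / p.toReal) : ℝ) : ℂ)) p (volume.restrict (Ioi 0)) ≤
      xNorm p f := by
  unfold xNorm
  split_ifs with h
  · subst h
    rw [eLpNorm_exponent_top]
    refine eLpNormEssSup_le_of_ae_enorm_bound ?_
    filter_upwards [ae_restrict_mem measurableSet_Ioi] with x hx
    simpa using le_iSup₂ (f := fun x (_ : x ∈ Ioi (0 : ℝ)) => ‖f x‖ₑ) x hx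
  · exact le_rfl

lemma xNorm_eq_lintegral {p : ℝ≥0∞} (hp : p ≠ 0) (hp' : p ≠ ∞) (f : ℝ → ℂ) :
    xNorm p f =
      (∫⁻ x in Ioi (0 : ℝ), ‖f x‖ₑ ^ p.toReal * ENNReal.ofReal x⁻¹) ^ (1 / p.toReal) := by
  have hpr : 0 < p.toReal := ENNReal.toReal_pos hp hp'
  rw [xNorm, if_neg hp', eLpNorm_eq_lintegral_rpow_enorm_toReal hp hp']
  congr 1
  refine setLIntegral_congr_fun measurableSet_Ioi fun x (hx : 0 < x) => ?_
  rw [enorm_mul, ENNReal.mul_rpow_of_nonneg _ _ hpr.le, ← ofReal_norm (Complex.ofReal _),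
    Complex.norm_real, Real.norm_of_nonneg (by positivity),
    ENNReal.ofReal_rpow_of_pos (by positivity), ← Real.rpow_mul hx.le,
    div_mul_cancel₀ _ hpr.ne', Real.rpow_neg_one]

lemma lintegral_Ioi_comp_mul_left_mul_inv (φ : ℝ → ℝ≥0∞) {c : ℝ} (hc : 0 < c) :
    ∫⁻ x in Ioi (0 : ℝ), φ (c * x) * ENNReal.ofReal x⁻¹ =
      ∫⁻ x in Ioi (0 : ℝ), φ x * ENNReal.ofReal x⁻¹ := by
  have himage : (fun x => c * x) '' Ioi 0 = Ioi (0 : ℝ) := by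
    rw [Set.image_mul_left_Ioi hc, mul_zero]
  conv_rhs => rw [← himage]
  rw [lintegral_image_eq_lintegral_abs_deriv_mul (f' := fun _ => c) measurableSet_Ioi
    (fun x _ => by simpa using ((hasDerivAt_id x).const_mul c).hasDerivWithinAt)
    (mul_right_injective₀ hc.ne').injOn]
  refine setLIntegral_congr_fun measurableSet_Ioi fun x (hx : 0 < x) => ?_
  simp only [abs_of_pos hc]
  rw [mul_left_comm, ← ENNReal.ofReal_mul hc.le]
  congr 2
  field_simp

lemma xNorm_U (p : ℝ≥0∞) (t : ℝ) (f : ℝ → ℂ) : xNorm p (U t f) = xNorm p f := by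
  have hc : 0 < Real.exp t := Real.exp_pos t
  rcases eq_or_ne p 0 with rfl | hp
  · simp [xNorm]
  rcases eq_or_ne p ∞ with rfl | hp'
  · have himage : (fun x : ℝ => Real.exp t * x) '' Ioi 0 = Ioi 0 := by
      rw [Set.image_mul_left_Ioi hc, mul_zero]
    simp only [xNorm, if_pos, U]
    conv_rhs => rw [← himage, iSup_image]
  · rw [xNorm_eq_lintegral hp hp', xNorm_eq_lintegral hp hp']
    exact congrArg (· ^ _)
      (lintegral_Ioi_comp_mul_left_mul_inv (fun x => ‖f x‖ₑ ^ p.toReal) hc)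

lemma quasiMeasurePreserving_exp_mul (t : ℝ) :
    Measure.QuasiMeasurePreserving (fun x => Real.exp t * x)
      (volume.restrict (Ioi 0)) (volume.restrict (Ioi 0)) := by
  refine Measure.QuasiMeasurePreserving.restrict ⟨by fun_prop, ?_⟩ fun x hx =>
    mul_pos (Real.exp_pos t) hx
  rw [Real.map_volume_mul_left (Real.exp_pos t).ne']
  exact Measure.smul_absolutelyContinuous

lemma aestronglyMeasurable_U {f : ℝ → ℂ} (hf : AEStronglyMeasurable f (volume.restrict (Ioi 0)))
    (t : ℝ) : AEStronglyMeasurable (U t f) (volume.restrict (Ioi 0)) :=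
  hf.comp_quasiMeasurePreserving (quasiMeasurePreserving_exp_mul t)

lemma aestronglyMeasurable_weighted {f : ℝ → ℂ}
    (hf : AEStronglyMeasurable f (volume.restrict (Ioi 0))) (a : ℝ) :
    AEStronglyMeasurable (fun x : ℝ => f x * ((x ^ a : ℝ) : ℂ)) (volume.restrict (Ioi 0)) :=
  hf.mul (by fun_prop)

variable (p q : ℝ≥0∞) [p.HolderConjugate q]

lemma rpow_mul_rpow_conjugate {x : ℝ} (hx : 0 < x) :
    x ^ (-1 / p.toReal) * x ^ (-1 / q.toReal) = x⁻¹ := by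
  have hsum : p⁻¹ + q⁻¹ = 1 := ENNReal.HolderConjugate.inv_add_inv_eq_one p q
  have hp : p⁻¹ ≠ ∞ := fun h => by simp [h] at hsum
  have hq : q⁻¹ ≠ ∞ := fun h => by simp [h] at hsum
  have hreal : p.toReal⁻¹ + q.toReal⁻¹ = 1 := by
    rw [← ENNReal.toReal_inv, ← ENNReal.toReal_inv, ← ENNReal.toReal_add hp hq, hsum,
      ENNReal.toReal_one]
  rw [← Real.rpow_add hx, div_eq_mul_inv, div_eq_mul_inv, ← mul_add, hreal, mul_one,
    Real.rpow_neg_one]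

variable {p q} {f h g : ℝ → ℂ}

lemma lintegral_pairing_le (hf : AEStronglyMeasurable f (volume.restrict (Ioi 0)))
    (hg : AEStronglyMeasurable g (volume.restrict (Ioi 0))) (t : ℝ) :
    ∫⁻ x in Ioi (0 : ℝ), ‖f (Real.exp t * x) * g x / (x : ℂ)‖ₑ ≤ xNorm p f * xNorm q g := by
  calc ∫⁻ x in Ioi (0 : ℝ), ‖f (Real.exp t * x) * g x / (x : ℂ)‖ₑ
      = eLpNorm ((fun x : ℝ => U t f x * ((x ^ (-1 / p.toReal) : ℝ) : ℂ)) •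
          (fun x : ℝ => g x * ((x ^ (-1 / q.toReal) : ℝ) : ℂ))) 1 (volume.restrict (Ioi 0)) := by
        rw [eLpNorm_one_eq_lintegral_enorm]
        refine setLIntegral_congr_fun measurableSet_Ioi fun x hx => ?_
        simp only [Pi.smul_apply', smul_eq_mul, U]
        rw [mul_mul_mul_comm, ← Complex.ofReal_mul, rpow_mul_rpow_conjugate p q hx,
          Complex.ofReal_inv, div_eq_mul_inv]
    _ ≤ xNorm p (U t f) * xNorm q g :=
        (eLpNorm_smul_le_mul_eLpNorm (aestronglyMeasurable_weighted hg _)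
          (aestronglyMeasurable_weighted (aestronglyMeasurable_U hf t) _)).trans
          (mul_le_mul' (eLpNorm_weighted_le_xNorm p _) (eLpNorm_weighted_le_xNorm q g))
    _ = xNorm p f * xNorm q g := by rw [xNorm_U]

lemma integrableOn_pairing (hf : MemX p f) (hg : MemX q g) (t : ℝ) :
    IntegrableOn (fun x : ℝ => f (Real.exp t * x) * g x / (x : ℂ)) (Ioi 0) :=
  ⟨((aestronglyMeasurable_U hf.1 t).mul hg.1).div₀ (by fun_prop),
    (lintegral_pairing_le hf.1 hg.1 t).trans_lt (ENNReal.mul_lt_top hf.2 hg.2)⟩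

lemma enorm_pairing_le (hf : AEStronglyMeasurable f (volume.restrict (Ioi 0)))
    (hg : AEStronglyMeasurable g (volume.restrict (Ioi 0))) (t : ℝ) :
    ‖pairing f g t‖ₑ ≤ xNorm p f * xNorm q g :=
  (enorm_integral_le_lintegral_enorm _).trans (lintegral_pairing_le hf hg t)

lemma slope_pairing_sub_pairing (hf : MemX p f) (hh : MemX p h) (hg : MemX q g) (t s : ℝ) :
    s⁻¹ • (pairing f g (t + s) - pairing f g t) - pairing h g t =
      pairing (fun x => (U s f x - f x) / (s : ℂ) - h x) g t := by
  have hslope : IntegrableOn (fun x : ℝ => s⁻¹ • (f (Real.exp (t + s) * x) * g x / (x : ℂ) -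
      f (Real.exp t * x) * g x / (x : ℂ))) (Ioi 0) :=
    ((integrableOn_pairing hf hg (t + s)).sub (integrableOn_pairing hf hg t)).smul s⁻¹
  simp only [pairing]
  rw [← integral_sub (integrableOn_pairing hf hg (t + s)) (integrableOn_pairing hf hg t),
    ← integral_smul, ← integral_sub hslope (integrableOn_pairing hh hg t)]
  congr 1 with x
  have hexp : Real.exp (t + s) * x = Real.exp s * (Real.exp t * x) := by
    rw [Real.exp_add]
    ring
  simp only [U, Complex.real_smul, Complex.ofReal_inv, hexp]
  ring

lemma hasDerivAt_pairing (hfh : IsTheta p f h) (hg : MemX q g) (t : ℝ) :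
    HasDerivAt (pairing f g) (pairing h g t) t := by
  obtain ⟨hf, hh, hlim⟩ := hfh
  rw [hasDerivAt_iff_tendsto_slope_zero, tendsto_iff_edist_tendsto_0]
  have hlim' := ENNReal.Tendsto.mul_const (b := xNorm q g) hlim (Or.inr hg.2.ne)
  rw [zero_mul] at hlim'
  refine tendsto_of_tendsto_of_tendsto_of_le_of_le tendsto_const_nhds hlim' (fun _ => zero_le)
    fun s => ?_
  have hmeas : AEStronglyMeasurable (fun x => (U s f x - f x) / (s : ℂ) - h x)
      (volume.restrict (Ioi 0)) :=
    (((aestronglyMeasurable_U hf.1 s).sub hf.1).div₀ (by fun_prop)).sub hh.1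
  rw [edist_eq_enorm_sub, slope_pairing_sub_pairing hf hh hg]
  exact enorm_pairing_le hmeas hg.1 t

lemma iteratedDeriv_pairing {F : ℕ → ℝ → ℂ} (hF : ∀ k, IsTheta p (F k) (F (k + 1)))
    (hg : MemX q g) (k : ℕ) : iteratedDeriv k (pairing (F 0) g) = pairing (F k) g := by
  induction k with
  | zero => exact iteratedDeriv_zero
  | succ k ih =>
    rw [iteratedDeriv_succ, ih]
    exact deriv_eq fun t => hasDerivAt_pairing (hF k) hg t

lemma memX_of_mem_bernsteinSpace {σ : ℝ} (hf : f ∈ bernsteinSpace p σ) : MemX p f := by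
  obtain ⟨F, rfl, hF, -⟩ := hf
  exact (hF 0).1

lemma contDiff_pairing {σ : ℝ} (hf : f ∈ bernsteinSpace p σ) (hg : MemX q g) :
    ContDiff ℝ (⊤ : ℕ∞) (pairing f g) := by
  obtain ⟨F, rfl, hF, -⟩ := hf
  refine contDiff_of_differentiable_iteratedDeriv fun k _ => ?_
  rw [iteratedDeriv_pairing hF hg]
  exact fun t => (hasDerivAt_pairing (hF k) hg t).differentiableAt

lemma norm_iteratedDeriv_pairing_le {σ : ℝ} (hσ : 0 ≤ σ) (hf : f ∈ bernsteinSpace p σ)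
    (hg : MemX q g) (k : ℕ) (t : ℝ) :
    ‖iteratedDeriv k (pairing f g) t‖ ≤ (xNorm p f * xNorm q g).toReal * σ ^ k := by
  have hf' := memX_of_mem_bernsteinSpace hf
  obtain ⟨F, rfl, hF, hbound⟩ := hf
  rw [iteratedDeriv_pairing hF hg]
  have hle : ‖pairing (F k) g t‖ₑ ≤ ENNReal.ofReal σ ^ k * (xNorm p (F 0) * xNorm q g) :=
    calc ‖pairing (F k) g t‖ₑ ≤ xNorm p (F k) * xNorm q g := enorm_pairing_le (hF k).1.1 hg.1 t
      _ ≤ ENNReal.ofReal σ ^ k * xNorm p (F 0) * xNorm q g := mul_le_mul' (hbound k) le_rfl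
      _ = _ := mul_assoc _ _ _
  have htop : ENNReal.ofReal σ ^ k * (xNorm p (F 0) * xNorm q g) ≠ ∞ :=
    ENNReal.mul_ne_top (ENNReal.pow_ne_top ENNReal.ofReal_ne_top)
      (ENNReal.mul_lt_top hf'.2 hg.2).ne
  have hreal := ENNReal.toReal_mono htop hle
  rwa [toReal_enorm, ENNReal.toReal_mul, ENNReal.toReal_pow, ENNReal.toReal_ofReal hσ,
    mul_comm] at hreal

end Pairing

lemma differentiable_samplingFactor (τ : ℤ → ℝ) (n : ℕ) :
    Differentiable ℂ fun z => samplingFactor τ z n := by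
  unfold samplingFactor
  fun_prop

lemma samplingFactor_natAbs_sub_one (τ : ℤ → ℝ) (z : ℂ) {k : ℤ} (hk : k ≠ 0) :
    samplingFactor τ z (k.natAbs - 1) = (1 - z / τ k) * (1 - z / τ (-k)) := by
  have hcast : ((k.natAbs - 1 : ℕ) : ℤ) + 1 = |k| := by
    rw [Int.abs_eq_natAbs]
    omega
  rw [samplingFactor, hcast]
  rcases abs_choice k with h | h
  · rw [h]
  · rw [h, neg_neg, mul_comm]

lemma samplingFactor_sub_one (τ : ℤ → ℝ) (z : ℂ) {n : ℕ} (ha : τ (n + 1) ≠ 0)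
    (hb : τ (-(n + 1)) ≠ 0) :
    samplingFactor τ z n - 1 = (z ^ 2 - z * ((τ (n + 1) + τ (-(n + 1)) : ℝ) : ℂ)) /
      ((τ (n + 1) * τ (-(n + 1)) : ℝ) : ℂ) := by
  have ha' : (τ (n + 1) : ℂ) ≠ 0 := by exact_mod_cast ha
  have hb' : (τ (-(n + 1)) : ℂ) ≠ 0 := by exact_mod_cast hb
  rw [samplingFactor]
  push_cast
  field_simp
  ring

/-- Real sequences which deviate from the integers by at most `L`, the admissible sampling nodes. -/
def NearIntegers (L : ℝ) (τ : ℤ → ℝ) : Prop :=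
  ∀ k : ℤ, |τ k - k| ≤ L

namespace NearIntegers

variable {τ : ℤ → ℝ} {L : ℝ}

lemma abs_intCast_le_two_mul (hτ : NearIntegers L τ) (hL : L < 1 / 2) (k : ℤ) :
    |(k : ℝ)| ≤ 2 * |τ k| := by
  rcases eq_or_ne k 0 with rfl | hk
  · simp
  · have hone : (1 : ℝ) ≤ |(k : ℝ)| := by exact_mod_cast Int.one_le_abs hk
    have htri := abs_sub_abs_le_abs_sub (k : ℝ) (τ k)
    rw [abs_sub_comm] at htri
    linarith [hτ k]

lemma ne_zero (hτ : NearIntegers L τ) (hL : L < 1 / 2) {k : ℤ} (hk : k ≠ 0) : τ k ≠ 0 := by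
  have hone : (1 : ℝ) ≤ |(k : ℝ)| := by exact_mod_cast Int.one_le_abs hk
  have hle := hτ.abs_intCast_le_two_mul hL k
  exact abs_pos.1 (by linarith)

lemma injective (hτ : NearIntegers L τ) (hL : L < 1 / 2) : Function.Injective τ := by
  intro k l hkl
  have hk := abs_le.1 (hτ k)
  have hl := abs_le.1 (hτ l)
  have hlt : |((k - l : ℤ) : ℝ)| < 1 := by
    push_cast
    exact abs_lt.2 ⟨by linarith, by linarith⟩
  exact sub_eq_zero.1 (Int.abs_lt_one_iff.1 (by exact_mod_cast hlt))

lemma ofReal_ne_ofReal (hτ : NearIntegers L τ) (hL : L < 1 / 2) {k l : ℤ} (hkl : k ≠ l) :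
    (τ k : ℂ) ≠ τ l :=
  fun h => hkl (hτ.injective hL (Complex.ofReal_injective h))

lemma one_sub_div_ne_zero (hτ : NearIntegers L τ) (hL : L < 1 / 2) {k : ℤ} (hk : k ≠ 0) {z : ℂ}
    (hz : z ≠ τ k) : 1 - z / (τ k : ℂ) ≠ 0 := by
  have hne : (τ k : ℂ) ≠ 0 := by exact_mod_cast hτ.ne_zero hL hk
  exact sub_ne_zero.2 fun h => hz ((div_eq_one_iff_eq hne).1 h.symm)

lemma samplingFactor_ne_zero (hτ : NearIntegers L τ) (hL : L < 1 / 2) {z : ℂ} {n : ℕ}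
    (hz : ∀ k : ℤ, k.natAbs = n + 1 → z ≠ τ k) : samplingFactor τ z n ≠ 0 :=
  mul_ne_zero (hτ.one_sub_div_ne_zero hL (by omega) (hz _ (by omega)))
    (hτ.one_sub_div_ne_zero hL (by omega) (hz _ (by omega)))

lemma samplingFactor_apply_node (hτ : NearIntegers L τ) (hL : L < 1 / 2) {k : ℤ} (hk : k ≠ 0) :
    samplingFactor τ (τ k) (k.natAbs - 1) = 0 := by
  have hne : (τ k : ℂ) ≠ 0 := by exact_mod_cast hτ.ne_zero hL hk
  rw [samplingFactor_natAbs_sub_one τ _ hk, div_self hne, sub_self, zero_mul]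

lemma deriv_samplingFactor_ne_zero (hτ : NearIntegers L τ) (hL : L < 1 / 2) {k : ℤ} (hk : k ≠ 0) :
    deriv (fun z => samplingFactor τ z (k.natAbs - 1)) (τ k) ≠ 0 := by
  have hne : (τ k : ℂ) ≠ 0 := by exact_mod_cast hτ.ne_zero hL hk
  have hderiv : HasDerivAt (fun z : ℂ => (1 - z / τ k) * (1 - z / τ (-k)))
      (-(1 / τ k) * (1 - τ k / τ (-k))) (τ k) := by
    have hlin (l : ℤ) : HasDerivAt (fun z : ℂ => 1 - z / τ l) (-(1 / τ l)) (τ k) :=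
      ((hasDerivAt_id _).div_const _).const_sub 1
    exact ((hlin k).mul (hlin (-k))).congr_deriv (by rw [div_self hne]; ring)
  simp only [samplingFactor_natAbs_sub_one τ _ hk]
  rw [hderiv.deriv]
  exact mul_ne_zero (neg_ne_zero.2 (one_div_ne_zero hne)) (hτ.one_sub_div_ne_zero hL (by omega)
    (hτ.ofReal_ne_ofReal hL (by omega)))

lemma norm_samplingFactor_sub_one_le (hτ : NearIntegers L τ) (hL : L < 1 / 2) (n : ℕ) (z : ℂ) :
    ‖samplingFactor τ z n - 1‖ ≤ 4 * (‖z‖ ^ 2 + ‖z‖) * (1 / ((n : ℝ) + 1) ^ 2) := by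
  have hpos := hτ (n + 1)
  have hneg := hτ (-(n + 1))
  have hlarge_pos := hτ.abs_intCast_le_two_mul hL (n + 1)
  have hlarge_neg := hτ.abs_intCast_le_two_mul hL (-(n + 1))
  have hn : |((n : ℝ) + 1)| = n + 1 := abs_of_pos (by positivity)
  push_cast at hpos hneg hlarge_pos hlarge_neg
  rw [abs_neg] at hlarge_neg
  rw [hn] at hlarge_pos hlarge_neg
  have hsum : |τ (n + 1) + τ (-(n + 1))| ≤ 1 := by
    rw [abs_le] at hpos hneg ⊢
    constructor <;> linarith
  have hprod : ((n : ℝ) + 1) ^ 2 / 4 ≤ |τ (n + 1) * τ (-(n + 1))| := by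
    rw [abs_mul]
    nlinarith [abs_nonneg (τ (n + 1)), abs_nonneg (τ (-(n + 1)))]
  rw [samplingFactor_sub_one τ z (hτ.ne_zero hL (by omega)) (hτ.ne_zero hL (by omega)), norm_div,
    Complex.norm_real, Real.norm_eq_abs]
  calc ‖z ^ 2 - z * ((τ (n + 1) + τ (-(n + 1)) : ℝ) : ℂ)‖ / |τ (n + 1) * τ (-(n + 1))|
      ≤ (‖z‖ ^ 2 + ‖z‖ * 1) / (((n : ℝ) + 1) ^ 2 / 4) := by
        gcongr
        refine (norm_sub_le _ _).trans ?_
        rw [norm_pow, norm_mul, Complex.norm_real, Real.norm_eq_abs]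
        gcongr
    _ = 4 * (‖z‖ ^ 2 + ‖z‖) * (1 / ((n : ℝ) + 1) ^ 2) := by
        field_simp

lemma normallyConvergentProduct_samplingFactor (hτ : NearIntegers L τ) (hL : L < 1 / 2) :
    NormallyConvergentProduct fun n z => samplingFactor τ z n where
  differentiable := differentiable_samplingFactor τ
  exists_summable_bound r := by
    have hsum : Summable fun n : ℕ => 1 / ((n : ℝ) + 1) ^ 2 := by
      simpa using (summable_nat_add_iff 1).2 (Real.summable_one_div_nat_pow.2 one_lt_two)
    refine ⟨_, hsum.mul_left (4 * (r ^ 2 + r)), fun n z hz => ?_⟩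
    refine (hτ.norm_samplingFactor_sub_one_le hL n z).trans ?_
    gcongr

lemma differentiable_generatingFunction (hτ : NearIntegers L τ) (hL : L < 1 / 2) :
    Differentiable ℂ (generatingFunction τ) :=
  (differentiable_id.sub_const _).mul
    (hτ.normallyConvergentProduct_samplingFactor hL).differentiable_tprod

lemma generatingFunction_ne_zero (hτ : NearIntegers L τ) (hL : L < 1 / 2) {z : ℂ}
    (hz : ∀ k : ℤ, z ≠ τ k) : generatingFunction τ z ≠ 0 :=
  mul_ne_zero (sub_ne_zero.2 (hz 0))
    ((hτ.normallyConvergentProduct_samplingFactor hL).tprod_ne_zero fun _ =>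
      hτ.samplingFactor_ne_zero hL fun k _ => hz k)

lemma tprod_samplingFactor_apply_node (hτ : NearIntegers L τ) (hL : L < 1 / 2) {k : ℤ}
    (hk : k ≠ 0) : ∏' n, samplingFactor τ (τ k) n = 0 :=
  tprod_of_exists_eq_zero ⟨_, hτ.samplingFactor_apply_node hL hk⟩

lemma generatingFunction_apply_node (hτ : NearIntegers L τ) (hL : L < 1 / 2) (k : ℤ) :
    generatingFunction τ (τ k) = 0 := by
  rcases eq_or_ne k 0 with rfl | hk
  · simp [generatingFunction]
  · rw [generatingFunction, hτ.tprod_samplingFactor_apply_node hL hk, mul_zero]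

lemma generatingFunction_eq_zero_iff (hτ : NearIntegers L τ) (hL : L < 1 / 2) {z : ℂ} :
    generatingFunction τ z = 0 ↔ ∃ k, z = τ k := by
  refine ⟨fun h => ?_, ?_⟩
  · contrapose! h
    exact hτ.generatingFunction_ne_zero hL h
  · rintro ⟨k, rfl⟩
    exact hτ.generatingFunction_apply_node hL k

lemma deriv_generatingFunction_ne_zero (hτ : NearIntegers L τ) (hL : L < 1 / 2) (k : ℤ) :
    deriv (generatingFunction τ) (τ k) ≠ 0 := by
  have hprod := hτ.normallyConvergentProduct_samplingFactor hL
  have hderiv : deriv (generatingFunction τ) (τ k) = ∏' n, samplingFactor τ (τ k) n +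
      ((τ k : ℂ) - τ 0) * deriv (fun z => ∏' n, samplingFactor τ z n) (τ k) := by
    refine (((hasDerivAt_id _).sub_const _).mul
      (hprod.differentiable_tprod _).hasDerivAt).deriv.trans ?_
    simp
  rw [hderiv]
  rcases eq_or_ne k 0 with rfl | hk
  · rw [sub_self, zero_mul, add_zero]
    exact hprod.tprod_ne_zero fun n =>
      hτ.samplingFactor_ne_zero hL fun l hl => hτ.ofReal_ne_ofReal hL (by omega)
  · rw [hτ.tprod_samplingFactor_apply_node hL hk, zero_add]
    refine mul_ne_zero (sub_ne_zero.2 (hτ.ofReal_ne_ofReal hL hk))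
      (hprod.deriv_tprod_ne_zero (hτ.samplingFactor_apply_node hL hk)
        (hτ.deriv_samplingFactor_ne_zero hL hk) fun n hn => ?_)
    exact hτ.samplingFactor_ne_zero hL fun l hl => hτ.ofReal_ne_ofReal hL (by omega)

end NearIntegers

lemma prod_range_samplingFactor (τ : ℤ → ℝ) (z : ℂ) (n : ℕ) :
    ∏ i ∈ Finset.range n, samplingFactor τ z i =
      ∏ k ∈ (Finset.Icc (-(n : ℤ)) n).erase 0, (1 - z / (τ k : ℂ)) := by
  induction n with
  | zero => simp
  | succ n ih =>
    have hset : (Finset.Icc (-((n + 1 : ℕ) : ℤ)) (n + 1 : ℕ)).erase 0 =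
        insert ((n : ℤ) + 1) (insert (-((n : ℤ) + 1)) ((Finset.Icc (-(n : ℤ)) n).erase 0)) := by
      ext k
      simp only [Finset.mem_erase, Finset.mem_insert, Finset.mem_Icc]
      omega
    rw [Finset.prod_range_succ, ih, hset, Finset.prod_insert, Finset.prod_insert, samplingFactor]
    · ring
    · simp
    · simp only [Finset.mem_insert, Finset.mem_erase, Finset.mem_Icc]
      omega

lemma samplingFactor_intCast (z : ℂ) (n : ℕ) :
    samplingFactor Int.cast z n = 1 - z ^ 2 / ((n : ℂ) + 1) ^ 2 := by
  have hne : (n : ℂ) + 1 ≠ 0 := by exact_mod_cast n.succ_ne_zero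
  rw [samplingFactor]
  push_cast
  field_simp
  ring

lemma nearIntegers_intCast {L : ℝ} (hL : 0 ≤ L) : NearIntegers L Int.cast :=
  fun k => by simpa using hL

lemma pi_mul_generatingFunction_intCast (z : ℂ) :
    Real.pi * generatingFunction Int.cast z = Complex.sin (Real.pi * z) := by
  have hprod := ((nearIntegers_intCast le_rfl).normallyConvergentProduct_samplingFactor
    one_half_pos).multipliable z
  refine tendsto_nhds_unique ?_ (Complex.tendsto_euler_sin_prod z)
  simpa [generatingFunction, ← samplingFactor_intCast, mul_assoc] using
    (hprod.hasProd.tendsto_prod_nat.const_mul (Real.pi * z))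

namespace NearIntegers

variable {τ : ℤ → ℝ} {L η : ℝ} {z : ℂ}

lemma nonneg (hτ : NearIntegers L τ) : 0 ≤ L :=
  (abs_nonneg _).trans (hτ 0)

lemma abs_intCast_sub_round_add_one_le (hτ : NearIntegers L τ) (hL : L < 1 / 2) (z : ℂ) (k : ℤ) :
    |(k : ℝ) - round z.re| + 1 ≤ ‖(τ k : ℂ) - z‖ + 2 := by
  have hre : |τ k - z.re| ≤ ‖(τ k : ℂ) - z‖ := by
    simpa using Complex.abs_re_le_norm ((τ k : ℂ) - z)
  have hround := abs_sub_round z.re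
  have hk := hτ k
  rw [abs_sub_comm] at hk
  linarith [abs_sub_le (k : ℝ) (τ k) (round z.re), abs_sub_le (τ k) z.re (round z.re)]

lemma norm_sub_le_abs_add_norm (hτ : NearIntegers L τ) (z : ℂ) (k : ℤ) :
    ‖z‖ - L ≤ |(k : ℝ)| + ‖(τ k : ℂ) - z‖ := by
  have hz := norm_sub_le (τ k : ℂ) ((τ k : ℂ) - z)
  rw [sub_sub_cancel, Complex.norm_real, Real.norm_eq_abs] at hz
  linarith [hτ k, abs_sub_abs_le_abs_sub (τ k) (k : ℝ)]

lemma abs_sub_le_norm_add_norm (hτ : NearIntegers L τ) (z : ℂ) (k : ℤ) :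
    |(k : ℝ)| - L ≤ ‖z‖ + ‖(τ k : ℂ) - z‖ := by
  have hz := norm_sub_norm_le (τ k : ℂ) z
  have hk := hτ k
  rw [Complex.norm_real, Real.norm_eq_abs] at hz
  rw [abs_sub_comm] at hk
  linarith [abs_sub_abs_le_abs_sub (k : ℝ) (τ k)]

lemma norm_sub_mul_one_div_le (hτ : NearIntegers L τ) {k : ℤ} (hk : k ≠ 0) (hz : z ≠ τ k) :
    (‖z‖ - L) * (1 / (|(k : ℝ)| * ‖(τ k : ℂ) - z‖)) ≤ 1 / |(k : ℝ)| + 1 / ‖(τ k : ℂ) - z‖ := by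
  have hk₀ : 0 < |(k : ℝ)| := abs_pos.2 (by exact_mod_cast hk)
  have hd₀ : 0 < ‖(τ k : ℂ) - z‖ := norm_pos_iff.2 (sub_ne_zero.2 hz.symm)
  rw [mul_one_div, div_add_div _ _ hk₀.ne' hd₀.ne', one_mul, mul_one, add_comm]
  gcongr
  exact hτ.norm_sub_le_abs_add_norm z k

lemma norm_sub_mul_sum_near_nodes_le (hτ : NearIntegers L τ) (hL : L < 1 / 2) (hη : 0 < η)
    (hz : 1 ≤ ‖z‖) (hd : ∀ k, η ≤ ‖(τ k : ℂ) - z‖) {S : Finset ℤ} (hS₀ : 0 ∉ S)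
    (hS : ∀ k ∈ S, k.natAbs ≤ ⌊4 * ‖z‖⌋₊) :
    (‖z‖ - L) * ∑ k ∈ S, 1 / (|(k : ℝ)| * ‖(τ k : ℂ) - z‖) ≤
      4 * Real.log ‖z‖ + (60 + 16 / η) := by
  have hlog := log_floor_add_round_le hz
  set n := ⌊4 * ‖z‖⌋₊ + (round z.re).natAbs + 1
  have hne : ∀ k ∈ S, k ≠ 0 := fun k hk => ne_of_mem_of_not_mem hk hS₀
  have hsum_index : ∑ k ∈ S, 1 / |(k : ℝ)| ≤ 2 * (1 + Real.log n) + 4 * (1 * (1 + 1 / 1)) :=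
    sum_one_div_le_two_mul_log (m := 0) one_pos zero_le_one
      (fun k hk => by exact_mod_cast Int.one_le_abs (hne k hk)) (fun k _ => by simp)
      fun k hk => by have := hS k hk; omega
  have hsum_node : ∑ k ∈ S, 1 / ‖(τ k : ℂ) - z‖ ≤
      2 * (1 + Real.log n) + 4 * (2 * (1 + 2 / η)) :=
    sum_one_div_le_two_mul_log hη zero_le_two (fun k _ => hd k)
      (fun k _ => hτ.abs_intCast_sub_round_add_one_le hL z k)
      fun k hk => by have := hS k hk; omega
  calc (‖z‖ - L) * ∑ k ∈ S, 1 / (|(k : ℝ)| * ‖(τ k : ℂ) - z‖)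
      ≤ ∑ k ∈ S, (1 / |(k : ℝ)| + 1 / ‖(τ k : ℂ) - z‖) := by
        rw [Finset.mul_sum]
        refine Finset.sum_le_sum fun k hk => hτ.norm_sub_mul_one_div_le (hne k hk) fun h => ?_
        have := hd k
        rw [h, sub_self, norm_zero] at this
        linarith
    _ ≤ 4 * Real.log ‖z‖ + (60 + 16 / η) := by
        rw [Finset.sum_add_distrib]
        have : 4 * (2 * (1 + 2 / η)) = 8 + 16 / η := by ring
        linarith

lemma sum_near_nodes_le (hτ : NearIntegers L τ) (hL : L < 1 / 2) (hη : 0 < η) (hz : 1 ≤ ‖z‖)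
    (hd : ∀ k, η ≤ ‖(τ k : ℂ) - z‖) {S : Finset ℤ} (hS₀ : 0 ∉ S)
    (hS : ∀ k ∈ S, k.natAbs ≤ ⌊4 * ‖z‖⌋₊) :
    ∑ k ∈ S, ‖z‖ / (|(k : ℝ)| * ‖(τ k : ℂ) - z‖) ≤ 4 * Real.log ‖z‖ + (124 + 32 / η) := by
  have hsub := hτ.norm_sub_mul_sum_near_nodes_le hL hη hz hd hS₀ hS
  simp_rw [← mul_one_div ‖z‖]
  rw [← Finset.mul_sum]
  set X := ∑ k ∈ S, 1 / (|(k : ℝ)| * ‖(τ k : ℂ) - z‖)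
  have : 0 ≤ X := Finset.sum_nonneg fun _ _ => by positivity
  -- Since `‖z‖ - L ≥ ‖z‖ / 2`, the sum itself is bounded, up to a constant, by `log ‖z‖ / ‖z‖ < 1`.
  have hXle : X ≤ 2 * (4 + (60 + 16 / η)) := by
    have hlog : Real.log ‖z‖ ≤ ‖z‖ := (Real.log_le_self (by positivity))
    have hhalf : ‖z‖ / 2 * X ≤ (‖z‖ - L) * X := by gcongr; linarith
    have hc : 60 + 16 / η ≤ ‖z‖ * (60 + 16 / η) := le_mul_of_one_le_left (by positivity) hz
    have : ‖z‖ * X ≤ ‖z‖ * (2 * (4 + (60 + 16 / η))) := by linarith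
    exact le_of_mul_le_mul_left this (by positivity)
  have hLX : L * X ≤ 1 / 2 * (2 * (4 + (60 + 16 / η))) := by gcongr
  have : 2 * (16 / η) = 32 / η := by ring
  linarith

lemma sum_far_nodes_le (hτ : NearIntegers L τ) (hL : L < 1 / 2) (hz : 1 ≤ ‖z‖) {S : Finset ℤ}
    (hS : ∀ k ∈ S, ⌊4 * ‖z‖⌋₊ < k.natAbs) :
    ∑ k ∈ S, ‖z‖ / (|(k : ℝ)| * ‖(τ k : ℂ) - z‖) ≤ 2 := by
  calc ∑ k ∈ S, ‖z‖ / (|(k : ℝ)| * ‖(τ k : ℂ) - z‖)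
      ≤ ∑ k ∈ S, 2 * ‖z‖ * (1 / (k : ℝ) ^ 2) := by
        refine Finset.sum_le_sum fun k hk => ?_
        have hk : 4 * ‖z‖ < |(k : ℝ)| := by
          simpa [Nat.cast_natAbs] using Nat.lt_of_floor_lt (hS k hk)
        have hk₀ : 0 < |(k : ℝ)| := by linarith
        have hd : |(k : ℝ)| / 2 ≤ ‖(τ k : ℂ) - z‖ := by
          linarith [hτ.abs_sub_le_norm_add_norm z k]
        calc ‖z‖ / (|(k : ℝ)| * ‖(τ k : ℂ) - z‖) ≤ ‖z‖ / (|(k : ℝ)| * (|(k : ℝ)| / 2)) := by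
              gcongr
          _ = 2 * ‖z‖ * (1 / (k : ℝ) ^ 2) := by
              rw [← sq_abs (k : ℝ)]
              field_simp
    _ ≤ 2 * ‖z‖ * (4 / ((⌊4 * ‖z‖⌋₊ : ℝ) + 1)) := by
        rw [← Finset.mul_sum]
        gcongr
        exact sum_one_div_sq_le hS
    _ ≤ 2 * ‖z‖ * (4 / (4 * ‖z‖)) := by
        gcongr
        exact (Nat.lt_floor_add_one _).le
    _ = 2 := by field_simp

lemma sum_nodes_le (hτ : NearIntegers L τ) (hL : L < 1 / 2) (hη : 0 < η) (hz : 1 ≤ ‖z‖)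
    (hd : ∀ k, η ≤ ‖(τ k : ℂ) - z‖) {S : Finset ℤ} (hS₀ : 0 ∉ S) :
    ∑ k ∈ S, ‖z‖ / (|(k : ℝ)| * ‖(τ k : ℂ) - z‖) ≤ 4 * Real.log ‖z‖ + (126 + 32 / η) := by
  rw [← Finset.sum_filter_add_sum_filter_not S (fun k => k.natAbs ≤ ⌊4 * ‖z‖⌋₊)]
  have hnear := hτ.sum_near_nodes_le hL hη hz hd
    (S := S.filter fun k => k.natAbs ≤ ⌊4 * ‖z‖⌋₊) (by simp [hS₀])
    fun k hk => (Finset.mem_filter.1 hk).2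
  have hfar := hτ.sum_far_nodes_le hL hz
    (S := S.filter fun k => ¬ k.natAbs ≤ ⌊4 * ‖z‖⌋₊) fun k hk =>
      not_le.1 (Finset.mem_filter.1 hk).2
  linarith

lemma prod_norm_one_sub_div_le (hτ : NearIntegers L τ) (hL : L < 1 / 2) (hη : 0 < η)
    (hz : 1 ≤ ‖z‖) (hd : ∀ k, η ≤ ‖(τ k : ℂ) - z‖) {S : Finset ℤ} (hS₀ : 0 ∉ S) :
    ∏ k ∈ S, ‖1 - z / (k : ℂ)‖ ≤
      (∏ k ∈ S, ‖1 - z / (τ k : ℂ)‖) * (Real.exp (L * (126 + 32 / η)) * ‖z‖ ^ (4 * L)) := by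
  calc ∏ k ∈ S, ‖1 - z / (k : ℂ)‖
      ≤ ∏ k ∈ S, ‖1 - z / (τ k : ℂ)‖ *
          Real.exp (L * (‖z‖ / (|(k : ℝ)| * ‖(τ k : ℂ) - z‖))) := by
        refine Finset.prod_le_prod (fun _ _ => norm_nonneg _) fun k hk => ?_
        have hk₀ : k ≠ 0 := ne_of_mem_of_not_mem hk hS₀
        have hdist : ‖(τ k : ℂ) - k‖ ≤ L := by
          rw [← Complex.ofReal_intCast, ← Complex.ofReal_sub, Complex.norm_real]
          exact hτ k
        refine (norm_one_sub_div_le_mul_exp (by exact_mod_cast hτ.ne_zero hL hk₀)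
          (by exact_mod_cast hk₀) (norm_pos_iff.1 (hη.trans_le (hd k)))).trans ?_
        rw [Complex.norm_intCast]
        gcongr
    _ = (∏ k ∈ S, ‖1 - z / (τ k : ℂ)‖) *
          Real.exp (L * ∑ k ∈ S, ‖z‖ / (|(k : ℝ)| * ‖(τ k : ℂ) - z‖)) := by
        rw [Finset.prod_mul_distrib, Finset.mul_sum, Real.exp_sum]
    _ ≤ _ := by
        rw [Real.rpow_def_of_pos (by positivity), ← Real.exp_add]
        have hL₀ := hτ.nonneg
        have hsum := mul_le_mul_of_nonneg_left (hτ.sum_nodes_le hL hη hz hd hS₀) hL₀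
        gcongr
        linarith

lemma norm_tprod_samplingFactor_intCast_le (hτ : NearIntegers L τ) (hL : L < 1 / 2) (hη : 0 < η)
    (hz : 1 ≤ ‖z‖) (hd : ∀ k, η ≤ ‖(τ k : ℂ) - z‖) :
    ‖∏' n, samplingFactor Int.cast z n‖ ≤
      ‖∏' n, samplingFactor τ z n‖ * (Real.exp (L * (126 + 32 / η)) * ‖z‖ ^ (4 * L)) := by
  have hlim {L' : ℝ} {τ' : ℤ → ℝ} (hτ' : NearIntegers L' τ') (hL' : L' < 1 / 2) :=
    ((hτ'.normallyConvergentProduct_samplingFactor hL').multipliable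
      z).hasProd.tendsto_prod_nat.norm
  refine le_of_tendsto_of_tendsto' (hlim (nearIntegers_intCast (le_refl 0)) (by norm_num))
    ((hlim hτ hL).mul_const _) fun n => ?_
  simp only [prod_range_samplingFactor, norm_prod, Complex.ofReal_intCast]
  exact hτ.prod_norm_one_sub_div_le hL hη hz hd (Finset.notMem_erase _ _)

lemma norm_le_two_mul_norm_sub (hτ : NearIntegers L τ) (hL : L < 1 / 2) (hz : 1 ≤ ‖z‖) :
    ‖z‖ ≤ 2 * ‖z - τ 0‖ := by
  have hnode := hτ 0
  have htri := norm_sub_norm_le z (τ 0 : ℂ)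
  rw [Complex.norm_real, Real.norm_eq_abs] at htri
  rw [Int.cast_zero, sub_zero] at hnode
  linarith

lemma exists_norm_sin_le (hτ : NearIntegers L τ) (hL : L < 1 / 2) (hη : 0 < η) :
    ∃ C, 0 ≤ C ∧ ∀ z : ℂ, 1 ≤ ‖z‖ → (∀ k, η ≤ ‖(τ k : ℂ) - z‖) →
      ‖Complex.sin (Real.pi * z)‖ ≤ C * ‖z‖ ^ (4 * L) * ‖generatingFunction τ z‖ := by
  refine ⟨2 * Real.pi * Real.exp (L * (126 + 32 / η)), by positivity, fun z hz hd => ?_⟩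
  rw [← pi_mul_generatingFunction_intCast, norm_mul, generatingFunction, generatingFunction,
    norm_mul, norm_mul, Int.cast_zero, Complex.ofReal_zero, sub_zero, Complex.norm_real,
    Real.norm_of_nonneg Real.pi_pos.le]
  calc Real.pi * (‖z‖ * ‖∏' n, samplingFactor Int.cast z n‖)
      ≤ Real.pi * ((2 * ‖z - τ 0‖) * (‖∏' n, samplingFactor τ z n‖ *
          (Real.exp (L * (126 + 32 / η)) * ‖z‖ ^ (4 * L)))) := by
        gcongr
        exacts [hτ.norm_le_two_mul_norm_sub hL hz,
          hτ.norm_tprod_samplingFactor_intCast_le hL hη hz hd]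
    _ = _ := by ring

end NearIntegers

namespace NearIntegers

variable {τ : ℤ → ℝ} {L : ℝ}

lemma samplingKernel_apply_node (hτ : NearIntegers L τ) (hL : L < 1 / 2) (k l : ℤ) :
    samplingKernel τ k (τ l) = if k = l then 1 else 0 := by
  unfold samplingKernel
  split_ifs with hnode hkl hkl
  · rfl
  · exact absurd (hτ.injective hL (Complex.ofReal_injective hnode)).symm hkl
  · exact absurd (by rw [hkl]) hnode
  · rw [hτ.generatingFunction_apply_node hL, zero_div]

lemma deriv_sub_mul_generatingFunction_self (hτ : NearIntegers L τ) (hL : L < 1 / 2) (z : ℂ) :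
    deriv (fun w => (w - z) * generatingFunction τ w) z = generatingFunction τ z := by
  rw [deriv_fun_mul (by fun_prop) (hτ.differentiable_generatingFunction hL z)]
  simp

lemma deriv_sub_mul_generatingFunction_node (hτ : NearIntegers L τ) (hL : L < 1 / 2) (z : ℂ)
    (k : ℤ) : deriv (fun w => (w - z) * generatingFunction τ w) (τ k) =
      (τ k - z) * deriv (generatingFunction τ) (τ k) := by
  rw [deriv_fun_mul (by fun_prop) (hτ.differentiable_generatingFunction hL _),
    hτ.generatingFunction_apply_node hL, mul_zero, zero_add]

lemma circleIntegral_div_sub_mul_generatingFunction (hτ : NearIntegers L τ) (hL : L < 1 / 2)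
    {c : ℂ} {R : ℝ} {W : Finset ℤ} (hmem : ∀ k ∈ W, (τ k : ℂ) ∈ Metric.ball c R)
    (hnotMem : ∀ k ∉ W, (τ k : ℂ) ∉ Metric.closedBall c R) {f : ℂ → ℂ}
    (hf : DiffContOnCl ℂ f (Metric.ball c R)) {z : ℂ} (hz : z ∈ Metric.ball c R)
    (hzτ : ∀ k, z ≠ τ k) :
    ∮ w in C(c, R), f w / ((w - z) * generatingFunction τ w) =
      2 * Real.pi * Complex.I * (f z / generatingFunction τ z +
        ∑ k ∈ W, f (τ k) / ((τ k - z) * deriv (generatingFunction τ) (τ k))) := by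
  classical
  have hG := hτ.differentiable_generatingFunction hL
  have hinj : Set.InjOn (fun k => (τ k : ℂ)) W :=
    (Complex.ofReal_injective.comp (hτ.injective hL)).injOn
  have hznotMem : z ∉ W.image fun k => (τ k : ℂ) := by
    simpa only [Finset.mem_image, not_exists, not_and] using fun k _ => (hzτ k).symm
  rw [circleIntegral_div_of_simple_zeros (Metric.pos_of_mem_ball hz) hf
    (S := insert z (W.image fun k => (τ k : ℂ))) (Differentiable.diffContOnCl (by fun_prop)),
    Finset.sum_insert hznotMem, Finset.sum_image hinj,
    hτ.deriv_sub_mul_generatingFunction_self hL]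
  · simp only [hτ.deriv_sub_mul_generatingFunction_node hL]
  · rw [Finset.coe_insert, insert_subset_iff]
    exact ⟨hz, by simpa [subset_def] using hmem⟩
  · intro w hw
    rw [mul_eq_zero, sub_eq_zero, hτ.generatingFunction_eq_zero_iff hL, Finset.mem_insert,
      Finset.mem_image]
    refine or_congr_right ⟨?_, fun ⟨k, _, hk⟩ => ⟨k, hk.symm⟩⟩
    rintro ⟨k, rfl⟩
    exact ⟨k, by_contra fun hk => hnotMem k hk hw, rfl⟩
  · simp only [Finset.forall_mem_insert, Finset.forall_mem_image,
      hτ.deriv_sub_mul_generatingFunction_self hL, hτ.deriv_sub_mul_generatingFunction_node hL]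
    exact ⟨hτ.generatingFunction_ne_zero hL hzτ, fun k _ =>
      mul_ne_zero (sub_ne_zero.2 (hzτ k).symm) (hτ.deriv_generatingFunction_ne_zero hL k)⟩

lemma generatingFunction_mul_circleIntegral (hτ : NearIntegers L τ) (hL : L < 1 / 2)
    {c : ℂ} {R : ℝ} {W : Finset ℤ} (hmem : ∀ k ∈ W, (τ k : ℂ) ∈ Metric.ball c R)
    (hnotMem : ∀ k ∉ W, (τ k : ℂ) ∉ Metric.closedBall c R) {f : ℂ → ℂ}
    (hf : DiffContOnCl ℂ f (Metric.ball c R)) {z : ℂ} (hz : z ∈ Metric.ball c R) :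
    generatingFunction τ z * ∮ w in C(c, R), f w / ((w - z) * generatingFunction τ w) =
      2 * Real.pi * Complex.I * (f z - ∑ k ∈ W, f (τ k) * samplingKernel τ k z) := by
  by_cases hnode : ∃ k, z = τ k
  · obtain ⟨k, rfl⟩ := hnode
    have hk : k ∈ W := by_contra fun hk => hnotMem k hk (Metric.ball_subset_closedBall hz)
    simp [hτ.samplingKernel_apply_node hL, hτ.generatingFunction_apply_node hL, hk]
  · push Not at hnode
    have hterm (k : ℤ) : f (τ k) * samplingKernel τ k z = -(generatingFunction τ z *
        (f (τ k) / ((τ k - z) * deriv (generatingFunction τ) (τ k)))) := by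
      rw [samplingKernel, if_neg (hnode k), ← neg_sub z, neg_mul, div_neg, mul_neg, neg_neg,
        mul_comm (z - _)]
      ring
    rw [hτ.circleIntegral_div_sub_mul_generatingFunction hL hmem hnotMem hf hz hnode]
    simp only [hterm, Finset.sum_neg_distrib, ← Finset.mul_sum, sub_neg_eq_add]
    have hG := hτ.generatingFunction_ne_zero hL hnode
    field_simp

end NearIntegers

section Circles

/-- Centre of the circle through `-M - 1 / 2` and `N + 1 / 2` over which the remainder of the
sampling series is integrated. It is symmetric about the real axis. -/
noncomputable def circleCenter (M N : ℕ) : ℝ := ((N : ℝ) - M) / 2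

/-- Radius of the circle with centre `circleCenter M N` through `-M - 1 / 2` and `N + 1 / 2`. -/
noncomputable def circleRadius (M N : ℕ) : ℝ := ((N : ℝ) + M + 1) / 2

lemma circleRadius_pos (M N : ℕ) : 0 < circleRadius M N := by
  unfold circleRadius
  positivity

lemma abs_intCast_sub_circleCenter_le {M N : ℕ} {k : ℤ} (hk : k ∈ Finset.Icc (-(M : ℤ)) N) :
    |(k : ℝ) - circleCenter M N| ≤ circleRadius M N - 1 / 2 := by
  obtain ⟨hMk, hkN⟩ := Finset.mem_Icc.1 hk
  have hMk' : -(M : ℝ) ≤ k := by exact_mod_cast hMk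
  have hkN' : (k : ℝ) ≤ N := by exact_mod_cast hkN
  unfold circleCenter circleRadius
  exact abs_le.2 ⟨by linarith, by linarith⟩

lemma le_abs_intCast_sub_circleCenter {M N : ℕ} {k : ℤ} (hk : k ∉ Finset.Icc (-(M : ℤ)) N) :
    circleRadius M N + 1 / 2 ≤ |(k : ℝ) - circleCenter M N| := by
  have hout : k + 1 ≤ -(M : ℤ) ∨ (N : ℤ) + 1 ≤ k := by
    rw [Finset.mem_Icc] at hk
    omega
  unfold circleCenter circleRadius
  rcases hout with hkM | hNk
  · have hkM' : (k : ℝ) + 1 ≤ -M := by exact_mod_cast hkM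
    exact le_abs.2 (Or.inr (by linarith))
  · have hNk' : (N : ℝ) + 1 ≤ k := by exact_mod_cast hNk
    exact le_abs.2 (Or.inl (by linarith))

lemma abs_abs_sub_sub_radius_le {c R : ℝ} {w : ℂ} (hw : w ∈ Metric.sphere (c : ℂ) R) (x : ℝ) :
    |(|x - c| - R)| ≤ ‖(x : ℂ) - w‖ := by
  have hdist := abs_norm_sub_norm_le ((x : ℂ) - c) (w - c)
  rwa [mem_sphere_iff_norm.1 hw, sub_sub_sub_cancel_right, ← Complex.ofReal_sub,
    Complex.norm_real, Real.norm_eq_abs] at hdist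

lemma one_half_le_norm_intCast_sub {M N : ℕ} {w : ℂ}
    (hw : w ∈ Metric.sphere (circleCenter M N : ℂ) (circleRadius M N)) (k : ℤ) :
    1 / 2 ≤ ‖(k : ℂ) - w‖ := by
  have hdist := abs_abs_sub_sub_radius_le hw k
  rw [Complex.ofReal_intCast] at hdist
  refine le_trans ?_ hdist
  by_cases hk : k ∈ Finset.Icc (-(M : ℤ)) N
  · exact le_abs.2 (Or.inr (by linarith [abs_intCast_sub_circleCenter_le hk]))
  · exact le_abs.2 (Or.inl (by linarith [le_abs_intCast_sub_circleCenter hk]))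

lemma min_add_one_half_add_abs_circleCenter_le (M N : ℕ) :
    ((min M N : ℕ) : ℝ) + 1 / 2 + |circleCenter M N| ≤ circleRadius M N := by
  have hM : ((min M N : ℕ) : ℝ) ≤ M := by exact_mod_cast min_le_left M N
  have hN : ((min M N : ℕ) : ℝ) ≤ N := by exact_mod_cast min_le_right M N
  unfold circleCenter circleRadius
  rcases abs_cases (((N : ℝ) - M) / 2) with ⟨habs, _⟩ | ⟨habs, _⟩ <;> rw [habs] <;> linarith

lemma min_le_norm_of_mem_sphere {M N : ℕ} {w : ℂ}
    (hw : w ∈ Metric.sphere (circleCenter M N : ℂ) (circleRadius M N)) :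
    ((min M N : ℕ) : ℝ) ≤ ‖w‖ := by
  have hdist := norm_sub_le w (circleCenter M N)
  rw [mem_sphere_iff_norm.1 hw, Complex.norm_real, Real.norm_eq_abs] at hdist
  linarith [min_add_one_half_add_abs_circleCenter_le M N]

lemma mem_ball_of_norm_le_min {M N : ℕ} {z : ℂ} (hz : ‖z‖ ≤ (min M N : ℕ)) :
    z ∈ Metric.ball (circleCenter M N : ℂ) (circleRadius M N) := by
  rw [mem_ball_iff_norm]
  have hdist := norm_sub_le z (circleCenter M N)
  rw [Complex.norm_real, Real.norm_eq_abs] at hdist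
  linarith [min_add_one_half_add_abs_circleCenter_le M N]

end Circles

namespace NearIntegers

variable {τ : ℤ → ℝ} {L : ℝ}

lemma mem_ball (hτ : NearIntegers L τ) (hL : L < 1 / 2) {M N : ℕ} {k : ℤ}
    (hk : k ∈ Finset.Icc (-(M : ℤ)) N) :
    (τ k : ℂ) ∈ Metric.ball (circleCenter M N : ℂ) (circleRadius M N) := by
  rw [mem_ball_iff_norm, ← Complex.ofReal_sub, Complex.norm_real, Real.norm_eq_abs]
  linarith [abs_sub_le (τ k) k (circleCenter M N), hτ k, abs_intCast_sub_circleCenter_le hk]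

lemma notMem_closedBall (hτ : NearIntegers L τ) (hL : L < 1 / 2) {M N : ℕ} {k : ℤ}
    (hk : k ∉ Finset.Icc (-(M : ℤ)) N) :
    (τ k : ℂ) ∉ Metric.closedBall (circleCenter M N : ℂ) (circleRadius M N) := by
  rw [mem_closedBall_iff_norm, ← Complex.ofReal_sub, Complex.norm_real, Real.norm_eq_abs, not_le]
  have hnear := hτ k
  rw [abs_sub_comm] at hnear
  linarith [abs_sub_le (k : ℝ) (τ k) (circleCenter M N), le_abs_intCast_sub_circleCenter hk]

lemma one_half_sub_le_norm_sub (hτ : NearIntegers L τ) {w : ℂ}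
    (hw : ∀ k : ℤ, 1 / 2 ≤ ‖(k : ℂ) - w‖) (k : ℤ) : 1 / 2 - L ≤ ‖(τ k : ℂ) - w‖ := by
  have htri := norm_sub_le_norm_sub_add_norm_sub (k : ℂ) (τ k) w
  have hnear : ‖(k : ℂ) - τ k‖ ≤ L := by
    rw [norm_sub_rev]
    exact_mod_cast hτ k
  linarith [hw k]

lemma exists_exp_le_mul_norm_generatingFunction (hτ : NearIntegers L τ) (hL : L < 1 / 2) :
    ∃ C, 0 ≤ C ∧ ∀ w : ℂ, 1 ≤ ‖w‖ → (∀ k : ℤ, 1 / 2 ≤ ‖(k : ℂ) - w‖) →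
      Real.exp (Real.pi * |w.im|) ≤ C * ‖w‖ ^ (4 * L) * ‖generatingFunction τ w‖ := by
  obtain ⟨C, hC, hsin⟩ := hτ.exists_norm_sin_le hL (sub_pos.2 hL)
  refine ⟨3 * C, by positivity, fun w hw hdist => ?_⟩
  calc Real.exp (Real.pi * |w.im|) ≤ 3 * ‖Complex.sin (Real.pi * w)‖ :=
        exp_pi_mul_abs_im_le_norm_sin hdist
    _ ≤ 3 * (C * ‖w‖ ^ (4 * L) * ‖generatingFunction τ w‖) := by
        gcongr
        exact hsin w hw (hτ.one_half_sub_le_norm_sub hdist)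
    _ = 3 * C * ‖w‖ ^ (4 * L) * ‖generatingFunction τ w‖ := by ring

variable {Φ : ℂ → ℂ} {B δ : ℝ}

lemma exists_norm_div_generatingFunction_le (hτ : NearIntegers L τ) (hL : L < 1 / 2)
    (hB : ∀ z : ℂ, ‖Φ z‖ ≤ B * Real.exp ((Real.pi - δ) * |z.im|)) :
    ∃ C, 0 ≤ C ∧ ∀ w : ℂ, 1 ≤ ‖w‖ → (∀ k : ℤ, 1 / 2 ≤ ‖(k : ℂ) - w‖) →
      ‖Φ w / generatingFunction τ w‖ ≤ C * ‖w‖ ^ (4 * L) * Real.exp (-(δ * |w.im|)) := by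
  have hB₀ : 0 ≤ B := by simpa using (norm_nonneg _).trans (hB 0)
  obtain ⟨C, hC, hexp⟩ := hτ.exists_exp_le_mul_norm_generatingFunction hL
  refine ⟨B * C, by positivity, fun w hw hdist => ?_⟩
  have hG : generatingFunction τ w ≠ 0 := fun h => by
    have hle := hexp w hw hdist
    rw [h, norm_zero, mul_zero] at hle
    exact hle.not_gt (Real.exp_pos _)
  rw [norm_div, div_le_iff₀ (norm_pos_iff.2 hG)]
  calc ‖Φ w‖ ≤ B * Real.exp ((Real.pi - δ) * |w.im|) := hB w
    _ = B * Real.exp (-(δ * |w.im|)) * Real.exp (Real.pi * |w.im|) := by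
        rw [mul_assoc, ← Real.exp_add]
        ring_nf
    _ ≤ B * Real.exp (-(δ * |w.im|)) * (C * ‖w‖ ^ (4 * L) * ‖generatingFunction τ w‖) := by
        gcongr
        exact hexp w hw hdist
    _ = _ := by ring

lemma exists_norm_div_sub_mul_generatingFunction_le (hτ : NearIntegers L τ) (hL : L < 1 / 4)
    (hB : ∀ z : ℂ, ‖Φ z‖ ≤ B * Real.exp ((Real.pi - δ) * |z.im|)) :
    ∃ C, 0 ≤ C ∧ ∀ (ρ : ℝ) (w z : ℂ), 1 ≤ ρ → ρ ≤ ‖w‖ → 2 * ‖z‖ ≤ ρ →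
      (∀ k : ℤ, 1 / 2 ≤ ‖(k : ℂ) - w‖) → ‖Φ w / ((w - z) * generatingFunction τ w)‖ ≤
        C * ρ ^ (4 * L - 1) * Real.exp (-(δ * |w.im|)) := by
  obtain ⟨C, hC, hquot⟩ := hτ.exists_norm_div_generatingFunction_le (by linarith) hB
  refine ⟨2 * C, by positivity, fun ρ w z hρ hw hz hdist => ?_⟩
  have hw0 : 0 < ‖w‖ := by linarith
  have hwz : ‖w‖ / 2 ≤ ‖w - z‖ := by linarith [norm_sub_norm_le w z]
  calc ‖Φ w / ((w - z) * generatingFunction τ w)‖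
      = ‖w - z‖⁻¹ * ‖Φ w / generatingFunction τ w‖ := by
        rw [div_mul_eq_div_div_swap, norm_div, mul_comm, div_eq_mul_inv]
    _ ≤ (‖w‖ / 2)⁻¹ * (C * ‖w‖ ^ (4 * L) * Real.exp (-(δ * |w.im|))) := by
        gcongr
        exact hquot w (hρ.trans hw) hdist
    _ = 2 * C * ‖w‖ ^ (4 * L - 1) * Real.exp (-(δ * |w.im|)) := by
        rw [Real.rpow_sub_one hw0.ne']
        field_simp
    _ ≤ 2 * C * ρ ^ (4 * L - 1) * Real.exp (-(δ * |w.im|)) := by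
        gcongr 2 * C * ?_ * _
        exact Real.rpow_le_rpow_of_nonpos (by linarith) hw (by linarith)

lemma exists_norm_sub_sum_le (hτ : NearIntegers L τ) (hL : L < 1 / 4) (hδ : 0 < δ)
    (hΦ : Differentiable ℂ Φ) (hB : ∀ z : ℂ, ‖Φ z‖ ≤ B * Real.exp ((Real.pi - δ) * |z.im|)) :
    ∃ C, 0 ≤ C ∧ ∀ (M N : ℕ) (z : ℂ), 1 ≤ min M N → 2 * ‖z‖ ≤ (min M N : ℕ) →
      ‖Φ z - ∑ k ∈ Finset.Icc (-(M : ℤ)) (N : ℤ), Φ (τ k) * samplingKernel τ k z‖ ≤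
        ‖generatingFunction τ z‖ * (C * ((min M N : ℕ) : ℝ) ^ (4 * L - 1)) := by
  have hL' : L < 1 / 2 := by linarith
  obtain ⟨C, hC, hquot⟩ := hτ.exists_norm_div_sub_mul_generatingFunction_le hL hB
  refine ⟨C / δ, by positivity, fun M N z hone hz => ?_⟩
  have hresidue := congrArg norm (hτ.generatingFunction_mul_circleIntegral hL'
    (fun k => hτ.mem_ball hL') (fun k => hτ.notMem_closedBall hL') hΦ.diffContOnCl
    (mem_ball_of_norm_le_min (M := M) (N := N) (by linarith [norm_nonneg z])))
  have hintegral := norm_circleIntegral_le_of_norm_le_mul_exp_neg_abs_im hδ (circleRadius_pos M N)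
    (by positivity) fun w hw => hquot (min M N : ℕ) w z (by exact_mod_cast hone)
      (min_le_norm_of_mem_sphere hw) hz (one_half_le_norm_intCast_sub hw)
  have hnorm : ‖(2 * Real.pi * Complex.I : ℂ)‖ = 2 * Real.pi := by simp [Real.pi_pos.le]
  rw [norm_mul, norm_mul (2 * Real.pi * Complex.I : ℂ), hnorm] at hresidue
  refine le_of_mul_le_mul_left (hresidue.ge.trans ?_) Real.two_pi_pos
  calc _ ≤ ‖generatingFunction τ z‖ *
        (C * ((min M N : ℕ) : ℝ) ^ (4 * L - 1) * (2 * Real.pi / δ)) := by gcongr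
    _ = _ := by ring

theorem tendstoUniformlyOn_sampling (hτ : NearIntegers L τ) (hL : L < 1 / 4) (hδ : 0 < δ)
    (hΦ : Differentiable ℂ Φ) (hB : ∀ z : ℂ, ‖Φ z‖ ≤ B * Real.exp ((Real.pi - δ) * |z.im|))
    {K : Set ℂ} (hK : IsCompact K) :
    TendstoUniformlyOn (fun (N : ℕ × ℕ) (z : ℂ) => ∑ k ∈ Finset.Icc (-(N.1 : ℤ)) (N.2 : ℤ),
      Φ (τ k) * samplingKernel τ k z) Φ atTop K := by
  obtain ⟨r, hr⟩ := hK.isBounded.exists_norm_le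
  obtain ⟨g, hg⟩ := hK.exists_bound_of_continuousOn
    (hτ.differentiable_generatingFunction (by linarith)).continuous.continuousOn
  obtain ⟨C, hC, hremainder⟩ := hτ.exists_norm_sub_sum_le hL hδ hΦ hB
  have hmin : Tendsto (fun N : ℕ × ℕ => min N.1 N.2) atTop atTop :=
    tendsto_atTop.2 fun b => (eventually_ge_atTop (b, b)).mono fun N hN => le_min hN.1 hN.2
  have hlim : Tendsto (fun N : ℕ × ℕ => g * (C * ((min N.1 N.2 : ℕ) : ℝ) ^ (4 * L - 1))) atTop
      (𝓝 0) := by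
    have hrpow := (tendsto_rpow_neg_atTop (show 0 < 1 - 4 * L by linarith)).comp
      ((tendsto_natCast_atTop_atTop (R := ℝ)).comp hmin)
    simpa [Function.comp_def] using (hrpow.const_mul C).const_mul g
  rw [Metric.tendstoUniformlyOn_iff]
  intro ε hε
  filter_upwards [hlim.eventually_lt_const hε, hmin.eventually_ge_atTop 1,
    hmin.eventually_ge_atTop ⌈2 * r⌉₊] with N hsmall hone hlarge z hz
  rw [dist_eq_norm]
  refine (hremainder N.1 N.2 z hone ?_).trans_lt (lt_of_le_of_lt ?_ hsmall)
  · linarith [hr z hz, Nat.le_of_ceil_le hlarge]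
  · gcongr
    exact hg z hz

end NearIntegers

end Mellin

theorem mainTheorem9 (p q : ℝ≥0∞) (hp : 1 ≤ p) (hpq : 1 / p + 1 / q = 1)
    (δ : ℝ) (hδ : 0 < δ) (hδπ : δ < Real.pi)
    (τ : ℤ → ℝ) (hτ : ∃ L : ℝ, L < 1 / 4 ∧ ∀ k : ℤ, |τ k - (k : ℝ)| ≤ L)
    (f g : ℝ → ℂ) (hf : f ∈ Mellin.bernsteinSpace p (Real.pi - δ)) (hg : Mellin.MemX q g) :
    -- the objects in the formula are well defined
    (∀ z : ℂ, Multipliable (Mellin.samplingFactor τ z)) ∧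
    Differentiable ℂ (Mellin.generatingFunction τ) ∧
    (∀ k : ℤ, deriv (Mellin.generatingFunction τ) (τ k : ℂ) ≠ 0) ∧
    (∀ t : ℝ, IntegrableOn (fun x : ℝ => f (Real.exp t * x) * g x / (x : ℂ)) (Ioi 0)) ∧
    -- the entire extension of the pairing is the sum of the two-sided sampling series
    ∃ Φ : ℂ → ℂ, Differentiable ℂ Φ ∧ (∀ t : ℝ, Φ (t : ℂ) = Mellin.pairing f g t) ∧
      ∀ K : Set ℂ, IsCompact K →
        TendstoUniformlyOn
          (fun (N : ℕ × ℕ) (z : ℂ) => ∑ k ∈ Finset.Icc (-(N.1 : ℤ)) (N.2 : ℤ),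
            Mellin.pairing f g (τ k) * Mellin.samplingKernel τ k z)
          Φ atTop K := by
  obtain ⟨L, hL, hτ : Mellin.NearIntegers L τ⟩ := hτ
  have hL' : L < 1 / 2 := by linarith
  have hσ : 0 ≤ Real.pi - δ := by linarith
  have : p.HolderConjugate q := ENNReal.holderConjugate_iff.2 (by simpa using hpq)
  obtain ⟨Φ, hΦ, hreal, hbound⟩ := exists_entire_extension (Mellin.contDiff_pairing hf hg)
    (Mellin.norm_iteratedDeriv_pairing_le hσ hf hg) hσ
  refine ⟨(hτ.normallyConvergentProduct_samplingFactor hL').multipliable,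
    hτ.differentiable_generatingFunction hL', hτ.deriv_generatingFunction_ne_zero hL',
    Mellin.integrableOn_pairing (Mellin.memX_of_mem_bernsteinSpace hf) hg, Φ, hΦ, hreal,
    fun K hK => ?_⟩
  simp_rw [← hreal]
  exact hτ.tendstoUniformlyOn_sampling hL hδ hΦ hbound hK
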